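/- **Theorem 5.2.** Let $\mathbb T$ be a time scale, i.e. an unbounded closed subset of $[0,\infty)$ with $0\in\mathbb T$. Write $\sigma(t)=\inf\{u\in\mathbb T:u>t\}$ and $\mu(t)=\sigma(t)-t$ for $t\in\mathbb T$, and $[t]_{\mathbb T}=\max\{\tau\in\mathbb T:\tau\le t\}$ for $t\ge 0$. Call a function on $\mathbb T$ rd-continuous if it is continuous at every $t\in\mathbb T$ with $\mu(t)=0$ and has a finite left limit at every left-dense point of $\mathbb T$. A function $x:\mathbb T\to\mathbb R^n$ has $\Delta$-derivative $x^\Delta(t)=\gamma$ at $t\in\mathbb T$ if for every $\varepsilon>0$ the inequality $|x(\sigma(t))-x(s)-(\sigma(t)-s)\gamma|\le\varepsilon|\sigma(t)-s|$ holds for all $s\in\mathbb T$ close enough to $t$. Suppose that $\mathbb T$ is syndetic, i.e. $\sup_{t\in\mathbb T}\mu(t)<\infty$. Let $\mathbf A:\mathbb T\to M_{n,n}(\mathbb R)$ be bounded, rd-continuous and uniformly regressive, i.e. all matrices $E_n+\mu(t)\mathbf A(t)$, $t\in\mathbb T$, are invertible and their inverses are uniformly bounded. Suppose that for every bounded rd-continuous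 $\mathbf f:\mathbb T\to\mathbb R^n$ the system $x^\Delta=\mathbf A(t)x+\mathbf f(t)$ has a solution that is bounded on $\mathbb T$. Then the system $x^\Delta=\mathbf A(t)x$ is hyperbolic on $\mathbb T$, in the following sense. By a matrix logarithm we mean a map $\log$ from the invertible complex $n\times n$ matrices to the complex $n\times n$ matrices such that $\exp(\log M)=M$ for all invertible $M$, $\log$ is bounded on $\{M:\max(|M|,|M^{-1}|)\le R\}$ for every $R>0$, and $\log M\to 0$ as $M\to E_n$. Let $$s(t)=\int_0^t\frac{\log(1+\mu([\tau]_{\mathbb T}))}{\mu([\tau]_{\mathbb T})}\,d\tau,\qquad t\ge 0,$$ where the integrand is read as $1$ if $\mu([\tau]_{\mathbb T})=0$, and put $$A(s(t))=\mathbf A(t)\ \ (t\in\mathbb T),\qquad A(s(t))=\frac{\log\bigl(E_n+\mu([t]_{\mathbb T})\mathbf A([t]_{\mathbb T})\bigr)}{\log\bigl(1+\mu([t]_{\mathbb T})\bigr)}\ \ (t\ge 0,\ t\notin\mathbb T).$$ Then matrix logarithms exist and, for every choice of matrix logarithm, the associated ordinary differential equation $\dot x=A(s)x$ in $\mathbb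 C^n$ has an exponential dichotomy on $[0,\infty)$: $A$ is locally integrable on $[0,\infty)$, there is a continuous fundamental matrix $\Phi$ with $\Phi(t)=E_n+\int_0^tA(s)\Phi(s)\,ds$ for all $t\ge0$, and, with $\Phi(t,\tau)=\Phi(t)\Phi(\tau)^{-1}$, there are subspaces $U^+(t),U^-(t)$ of $\mathbb C^n$ $(t\ge 0)$ and constants $C,\lambda_0>0$ such that 1. $U^+(t)\oplus U^-(t)=\mathbb C^n$ for all $t\ge0$; 2. $\Phi(t,\tau)U^\pm(\tau)=U^\pm(t)$ for all $t,\tau\ge0$; 3. $|\Phi(t,\tau)x_0|\le Ce^{-\lambda_0(t-\tau)}|x_0|$ for all $t>\tau\ge 0$ and $x_0\in U^+(\tau)$; 4. $|\Phi(t,\tau)x_0|\le Ce^{\lambda_0(t-\tau)}|x_0|$ for all $0\le t<\tau$ and $x_0\in U^-(\tau)$. -/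

import Mathlib

open Set Filter Topology MeasureTheory
-- matrices carry the operator norm induced by the Euclidean norm
open scoped Matrix.Norms.L2Operator

/-- A time scale: an unbounded closed subset of `[0, ∞)`, normalised so that it contains `0`. -/
structure IsTimeScale (T : Set ℝ) : Prop where
  isClosed : IsClosed T
  subset_nonneg : T ⊆ Ici 0
  zero_mem : (0 : ℝ) ∈ T
  unbounded : ¬ BddAbove T

namespace TimeScale

/-- The forward jump `σ(t) = inf {u ∈ T : u > t}`. -/
noncomputable def sigma (T : Set ℝ) (t : ℝ) : ℝ := sInf {u | u ∈ T ∧ t < u}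

/-- The graininess `μ(t) = σ(t) - t`. -/
noncomputable def mu (T : Set ℝ) (t : ℝ) : ℝ := sigma T t - t

/-- `[t]_T = max {τ ∈ T : τ ≤ t}`, used for `t ≥ 0`. -/
noncomputable def floor (T : Set ℝ) (t : ℝ) : ℝ := sSup {τ | τ ∈ T ∧ τ ≤ t}

/-- The gaps of the time scale are bounded. -/
def IsSyndetic (T : Set ℝ) : Prop := BddAbove (mu T '' T)

/-- `t` is left-dense: it is an accumulation point of the part of `T` on its left. -/
def LeftDense (T : Set ℝ) (t : ℝ) : Prop := t ∈ closure (T ∩ Iio t)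

/-- Rd-continuity on `T`: continuity (along `T`) at right-dense points, and existence of the left
limit at left-dense points. Values outside `T` play no role. -/
def RdContinuous {E : Type*} [TopologicalSpace E] (T : Set ℝ) (f : ℝ → E) : Prop :=
  ∀ t ∈ T, (mu T t = 0 → ContinuousWithinAt f T t) ∧
    (LeftDense T t → ∃ l : E, Tendsto f (𝓝[T ∩ Iio t] t) (𝓝 l))

/-- `f` is bounded on `T`. -/
def BoundedOn {E : Type*} [Norm E] (T : Set ℝ) (f : ℝ → E) : Prop :=
  ∃ C : ℝ, ∀ t ∈ T, ‖f t‖ ≤ C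

/-- `f` is `Δ`-differentiable at `t` along `T`, with `Δ`-derivative `γ`. -/
def HasDeltaDeriv {E : Type*} [NormedAddCommGroup E] [NormedSpace ℝ E]
    (T : Set ℝ) (f : ℝ → E) (γ : E) (t : ℝ) : Prop :=
  ∀ ε > (0 : ℝ), ∀ᶠ s in 𝓝[T] t,
    ‖(f (sigma T t) - f s) - (sigma T t - s) • γ‖ ≤ ε * |sigma T t - s|

/-- `x` solves `x^Δ = A(t) x + f(t)` on `T`. -/
def IsSolution {n : ℕ} (T : Set ℝ) (A : ℝ → Matrix (Fin n) (Fin n) ℝ)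
    (f x : ℝ → EuclideanSpace ℝ (Fin n)) : Prop :=
  ∀ t ∈ T, HasDeltaDeriv T x (Matrix.toEuclideanLin (A t) (x t) + f t) t

/-- All matrices `E + μ(t) A(t)`, `t ∈ T`, are invertible, with uniformly bounded inverses. -/
def UniformlyRegressive {n : ℕ} (T : Set ℝ) (A : ℝ → Matrix (Fin n) (Fin n) ℝ) : Prop :=
  (∀ t ∈ T, IsUnit (1 + mu T t • A t)) ∧ BoundedOn T (fun t => (1 + mu T t • A t)⁻¹)

/-- `log (1 + m) / m`, extended by its limit `1` at `m = 0`. -/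
noncomputable def rate (m : ℝ) : ℝ := if m = 0 then 1 else Real.log (1 + m) / m

/-- The change of time `s(t) = ∫₀ᵗ log (1 + μ([τ]_T)) / μ([τ]_T) dτ`. -/
noncomputable def newTime (T : Set ℝ) (t : ℝ) : ℝ :=
  ∫ τ in (0 : ℝ)..t, rate (mu T (floor T τ))

end TimeScale

/-- A logarithm on the invertible complex `n × n` matrices: a right inverse of `exp`, bounded on
each set `{M : max (‖M‖, ‖M⁻¹‖) ≤ R}`, and tending to `0` at the identity matrix (so that
`log (E + μ A) / log (1 + μ) → A` as `μ → 0`, locally uniformly in `A`). -/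
structure IsMatrixLog (n : ℕ) (L : Matrix (Fin n) (Fin n) ℂ → Matrix (Fin n) (Fin n) ℂ) :
    Prop where
  exp_log : ∀ M, IsUnit M → NormedSpace.exp (L M) = M
  bounded : ∀ R : ℝ, ∃ K : ℝ, ∀ M, IsUnit M → ‖M‖ ≤ R → ‖M⁻¹‖ ≤ R → ‖L M‖ ≤ K
  near_one : Tendsto L (𝓝 1) (𝓝 0)

/-- `Φ` is the fundamental matrix on `[0, ∞)` of `x' = A(s) x` with `Φ(0) = E`, where `A` is
locally integrable on `[0, ∞)`. -/
def IsFundamentalMatrix {n : ℕ} (A Φ : ℝ → Matrix (Fin n) (Fin n) ℂ) : Prop :=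
  ContinuousOn Φ (Ici 0) ∧
    ∀ t : ℝ, 0 ≤ t → IntervalIntegrable A volume 0 t ∧ Φ t = 1 + ∫ s in (0 : ℝ)..t, A s * Φ s

/-- Hyperbolicity (exponential dichotomy on `[0, ∞)`) of `x' = A(s) x` in `ℂⁿ`, with Cauchy
matrix `Φ(t, τ) = Φ(t) Φ(τ)⁻¹`, stable spaces `U t` and unstable spaces `V t`. -/
def IsHyperbolicODE {n : ℕ} (A : ℝ → Matrix (Fin n) (Fin n) ℂ) : Prop :=
  ∃ Φ : ℝ → Matrix (Fin n) (Fin n) ℂ, IsFundamentalMatrix A Φ ∧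
  ∃ U V : ℝ → Submodule ℂ (EuclideanSpace ℂ (Fin n)), ∃ C > (0 : ℝ), ∃ lam > (0 : ℝ),
    (∀ t, 0 ≤ t → IsCompl (U t) (V t)) ∧
    (∀ t τ, 0 ≤ t → 0 ≤ τ →
      (U τ).map (Matrix.toEuclideanLin (Φ t * (Φ τ)⁻¹)) = U t ∧
      (V τ).map (Matrix.toEuclideanLin (Φ t * (Φ τ)⁻¹)) = V t) ∧
    (∀ t τ, 0 ≤ τ → τ < t → ∀ x ∈ U τ,
      ‖Matrix.toEuclideanLin (Φ t * (Φ τ)⁻¹) x‖ ≤ C * Real.exp (-lam * (t - τ)) * ‖x‖) ∧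
    (∀ t τ, 0 ≤ t → t < τ → ∀ x ∈ V τ,
      ‖Matrix.toEuclideanLin (Φ t * (Φ τ)⁻¹) x‖ ≤ C * Real.exp (lam * (t - τ)) * ‖x‖)

namespace TimeScale

open Classical in
/-- The coefficient, at the new time `u = s(t)` with `t ≥ 0`, of the ordinary differential equation
associated with `x^Δ = A(t) x`: it is `A(t)` if `t ∈ T`, and
`log (E + μ([t]_T) A([t]_T)) / log (1 + μ([t]_T))` if `t ∉ T`. -/
noncomputable def odeCoeff {n : ℕ} (L : Matrix (Fin n) (Fin n) ℂ → Matrix (Fin n) (Fin n) ℂ)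
    (T : Set ℝ) (A : ℝ → Matrix (Fin n) (Fin n) ℝ) (u : ℝ) : Matrix (Fin n) (Fin n) ℂ :=
  let t := Function.invFunOn (newTime T) (Ici 0) u
  if t ∈ T then (A t).map Complex.ofReal
  else (Real.log (1 + mu T (floor T t)))⁻¹ •
    L ((1 + mu T (floor T t) • A (floor T t)).map Complex.ofReal)

/-- Hyperbolicity of `x^Δ = A(t) x` on `T`: the associated ordinary differential equation is
hyperbolic, whichever matrix logarithm is used to build it (and there is a matrix logarithm). -/
def IsHyperbolic {n : ℕ} (T : Set ℝ) (A : ℝ → Matrix (Fin n) (Fin n) ℝ) : Prop :=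
  (∃ L, IsMatrixLog n L) ∧ ∀ L, IsMatrixLog n L → IsHyperbolicODE (odeCoeff L T A)

end TimeScale

/-!
The idea is to pass to the associated differential equation in the new time `s`, to show that it
inherits bounded solvability from the time scale, and to apply a discrete form of Perron's theorem.

*Matrix logarithms.* Among all `X` with `exp X = M` a matrix of least norm is chosen
(`exists_isMatrixLog`). Boundedness is then a local question, settled by the integral
`∫₀¹ (N - 1) (1 + t (N - 1))⁻¹ dt`, which is a logarithm of `N` as soon as the segment from `1` to
`N` consists of units; a rotation that moves a spectrum-free ray to the negative axis makes it so.
Since `exp` has derivative `1` at `0`, every matrix logarithm satisfies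
`log M = M - 1 + o(M - 1)` at `1`.

*The fundamental matrix.* By the last fact and uniform regressivity the coefficient of the
associated equation is bounded, and at right-dense points it is continuous along the time scale.
Hence the fundamental matrix `Φ` exists, solutions grow or decay at most exponentially, and `Φ ∘ s`
restricted to `T` solves the matrix equation `X^Δ = A X`: at right-dense points by differentiation,
across gaps because the coefficient is constant there and `exp (log (1 + μ A)) = 1 + μ A`
(`TimeScale.exists_fundamentalMatrix`).

*Transfer of solvability.* For continuous `h` with `Φ h` bounded, averaging over gaps yields a
bounded rd-continuous right-hand side on `T`. The bounded solution `x` provided by the hypothesis satisfies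
`Φ(s t)⁻¹ x(t) - ∫₀^{s t} h = const`, because the left side has zero `Δ`-derivative
(`TimeScale.eq_of_deltaDeriv_zero`). So `Φ(v) (ξ + ∫₀^v h)` is bounded for some `ξ`
(`TimeScale.exists_bounded_of_solvable`).

*Perron's theorem.* With `h` concentrated on unit intervals by the weight `2 sin² (π v)`, this says
that the difference equation `y (k + 1) = Φ(k + 1) Φ(k)⁻¹ y k + g k` has a bounded solution for every
bounded `g`. The open mapping theorem and test solutions `c k • x k` give a dichotomy at integer
times (`exists_dichotomy_of_solvable`), which bounded growth extends to all times.
-/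

/-! ### Logarithms in a Banach algebra -/

theorem commute_segment {R : Type*} [Ring R] [Algebra ℝ R] (N : R) (a b : ℝ) :
    Commute (1 + a • (N - 1)) (1 + b • (N - 1)) := by
  have h : Commute (N - 1) (N - 1) := Commute.refl _
  exact ((Commute.one_left _).add_left
    (((Commute.one_right _).add_right (h.smul_right b)).smul_left a))

theorem Commute.ringInverse_right {R : Type*} [MonoidWithZero R] {x y : R} (h : Commute x y) :
    Commute x (Ring.inverse y) := by
  by_cases hy : IsUnit y
  · obtain ⟨u, rfl⟩ := hy
    rw [Ring.inverse_unit]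
    exact h.units_inv_right
  · rw [Ring.inverse_non_unit _ hy]
    exact Commute.zero_right _

section BanachAlgebraLog

variable {𝔸 : Type*} [NormedRing 𝔸] [NormedAlgebra ℂ 𝔸] [CompleteSpace 𝔸]

theorem exp_add_of_commute_complex {x y : 𝔸} (h : Commute x y) :
    NormedSpace.exp (x + y) = NormedSpace.exp x * NormedSpace.exp y := by
  let _ := NormedAlgebra.restrictScalars ℚ ℂ 𝔸
  exact NormedSpace.exp_add_of_commute h

/-- The chain rule for `exp` along a curve whose values commute with the base value. -/
theorem hasDerivAt_exp_comp_of_commute {G : ℝ → 𝔸} {g : 𝔸} {t : ℝ} (hG : HasDerivAt G g t)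
    (hc : ∀ t', Commute (G t) (G t')) :
    HasDerivAt (fun t => NormedSpace.exp (G t)) (NormedSpace.exp (G t) * g) t := by
  have h0 : HasFDerivAt (NormedSpace.exp : 𝔸 → 𝔸) (1 : 𝔸 →L[ℝ] 𝔸) (G t - G t) := by
    rw [sub_self]; exact hasFDerivAt_exp_zero
  have h1 : HasDerivAt (fun t' => NormedSpace.exp (G t' - G t)) g t := by
    have := h0.comp_hasDerivAt (f := fun t' => G t' - G t) t (hG.sub_const (G t))
    exact this
  refine (h1.const_mul (NormedSpace.exp (G t))).congr_of_eventuallyEq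
    (Eventually.of_forall fun t' => ?_)
  change NormedSpace.exp (G t') = NormedSpace.exp (G t) * NormedSpace.exp (G t' - G t)
  rw [← exp_add_of_commute_complex ((hc t').sub_right (Commute.refl _))]
  congr 1
  abel

/-- If the segment from `1` to `N` consists of units with inverses of norm at most `C`, then
`∫₀¹ (N - 1) (1 + t (N - 1))⁻¹ dt` is a logarithm of `N`. -/
theorem exists_exp_eq_of_segment {N : 𝔸} {C : ℝ}
    (hN : ∀ t ∈ Icc (0 : ℝ) 1, IsUnit (1 + t • (N - 1)) ∧ ‖Ring.inverse (1 + t • (N - 1))‖ ≤ C) :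
    ∃ G : 𝔸, NormedSpace.exp G = N ∧ ‖G‖ ≤ C * ‖N - 1‖ := by
  set q : ℝ → 𝔸 := fun t => Ring.inverse (1 + t • (N - 1)) * (N - 1) with hq
  have hqc : ContinuousOn q (Icc 0 1) := by
    intro t ht
    obtain ⟨u, hu⟩ := (hN t ht).1
    have h1 : ContinuousAt (fun t : ℝ => 1 + t • (N - 1)) t := by fun_prop
    have h2 : ContinuousAt Ring.inverse (1 + t • (N - 1)) := by
      rw [← hu]; exact NormedRing.inverse_continuousAt u
    exact ((ContinuousAt.comp (f := fun t : ℝ => 1 + t • (N - 1)) h2 h1).mul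
      continuousAt_const).continuousWithinAt
  set g : ℝ → 𝔸 := IccExtend (zero_le_one' ℝ) ((Icc (0 : ℝ) 1).domRestrict q) with hg
  have hgc : Continuous g := (continuousOn_iff_continuous_domRestrict.1 hqc).Icc_extend'
  have hgq : ∀ t ∈ Icc (0 : ℝ) 1, g t = q t := fun t ht => by
    rw [hg, IccExtend_of_mem _ _ ht]; rfl
  have hgex : ∀ t, ∃ t' ∈ Icc (0 : ℝ) 1, g t = q t' := fun t =>
    ⟨_, (projIcc (0 : ℝ) 1 zero_le_one t).2, rfl⟩
  have hqq : ∀ a b, Commute (q a) (q b) := by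
    intro a b
    have h1 : ∀ a : ℝ, Commute (N - 1) (Ring.inverse (1 + a • (N - 1))) := fun a => by
      refine Commute.ringInverse_right ?_
      exact (Commute.one_right _).add_right ((Commute.refl (N - 1)).smul_right a)
    have h2 : Commute (Ring.inverse (1 + a • (N - 1))) (Ring.inverse (1 + b • (N - 1))) :=
      (commute_segment N a b).ringInverse_ringInverse
    exact (h2.mul_right (h1 a).symm).mul_left ((h1 b).mul_right (Commute.refl _))
  have hgg : ∀ a b, Commute (g a) (g b) := by
    intro a b
    obtain ⟨a', -, ha⟩ := hgex a
    obtain ⟨b', -, hb⟩ := hgex b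
    rw [ha, hb]; exact hqq _ _
  set G : ℝ → 𝔸 := fun t => ∫ x in (0 : ℝ)..t, g x with hG
  have hGd : ∀ t, HasDerivAt G (g t) t := fun t =>
    intervalIntegral.integral_hasDerivAt_right (hgc.intervalIntegrable _ _)
      (hgc.stronglyMeasurableAtFilter _ _) hgc.continuousAt
  have hcomm : ∀ (x : 𝔸), (∀ a, Commute x (g a)) → ∀ t, Commute x (G t) := by
    intro x hx t
    have h1 := ((ContinuousLinearMap.mul ℝ 𝔸) x).intervalIntegral_comp_comm
      (hgc.intervalIntegrable (μ := volume) 0 t)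
    have h2 := ((ContinuousLinearMap.mul ℝ 𝔸).flip x).intervalIntegral_comp_comm
      (hgc.intervalIntegrable (μ := volume) 0 t)
    simp only [ContinuousLinearMap.mul_apply', ContinuousLinearMap.flip_apply] at h1 h2
    change x * G t = G t * x
    rw [hG]
    simp only
    rw [← h1, ← h2]
    exact intervalIntegral.integral_congr fun a _ => (hx a)
  have hgG : ∀ a t, Commute (g a) (G t) := fun a t => hcomm _ (fun b => hgg a b) t
  have hGG : ∀ a t, Commute (G a) (G t) := fun a t => hcomm _ (fun b => (hgG b a).symm) t
  have hEd : ∀ t, HasDerivAt (fun t => NormedSpace.exp (-G t))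
      (NormedSpace.exp (-G t) * (-g t)) t := fun t =>
    hasDerivAt_exp_comp_of_commute (hGd t).neg fun t' => (hGG t t').neg_left.neg_right
  have hLd : ∀ t : ℝ, HasDerivAt (fun t : ℝ => 1 + t • (N - 1)) (N - 1) t := fun t => by
    simpa using ((hasDerivAt_id t).smul_const (N - 1)).const_add 1
  have hF : ∀ t ∈ Icc (0 : ℝ) 1, HasDerivAt (fun t => NormedSpace.exp (-G t) * (1 + t • (N - 1)))
      0 t := by
    intro t ht
    refine ((hEd t).mul (hLd t)).congr_deriv ?_
    rw [hgq t ht, mul_assoc, ← mul_add]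
    have : -q t * (1 + t • (N - 1)) = -(N - 1) := by
      have hc : Commute (N - 1) (1 + t • (N - 1)) :=
        (Commute.one_right _).add_right ((Commute.refl (N - 1)).smul_right t)
      rw [neg_mul, hq]
      simp only
      rw [mul_assoc, hc.eq, ← mul_assoc, Ring.inverse_mul_cancel _ (hN t ht).1, one_mul]
    rw [this, neg_add_cancel, mul_zero]
  have hconst := constant_of_has_deriv_right_zero
    (f := fun t : ℝ => NormedSpace.exp (-G t) * (1 + t • (N - 1))) (a := 0) (b := 1)
    (fun t ht => (hF t ht).continuousAt.continuousWithinAt)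
    (fun t ht => (hF t (Ico_subset_Icc_self ht)).hasDerivWithinAt) 1 (by simp)
  have hG0 : G 0 = 0 := by simp [hG]
  simp only [hG0, neg_zero, NormedSpace.exp_zero, zero_smul, add_zero, mul_one, one_smul,
    add_sub_cancel] at hconst
  refine ⟨G 1, ?_, ?_⟩
  · have h1 : NormedSpace.exp (G 1) * NormedSpace.exp (-G 1) = 1 := by
      rw [← exp_add_of_commute_complex (Commute.refl (G 1)).neg_right, add_neg_cancel,
        NormedSpace.exp_zero]
    calc NormedSpace.exp (G 1) = NormedSpace.exp (G 1) * (NormedSpace.exp (-G 1) * N) := by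
          rw [hconst, mul_one]
      _ = N := by rw [← mul_assoc, h1, one_mul]
  · have := intervalIntegral.norm_integral_le_of_norm_le_const (a := 0) (b := 1) (f := g)
      (C := C * ‖N - 1‖) (fun t _ => by
        obtain ⟨t', ht', h⟩ := hgex t
        rw [h]
        exact (norm_mul_le _ _).trans (by gcongr; exact (hN t' ht').2))
    simpa using this

/-- Invertibility of the segment from `1` to `N` persists for nearby end points, with a uniform
bound on the inverses. -/
theorem eventually_segment_bound {N : 𝔸}
    (hN : ∀ t ∈ Icc (0 : ℝ) 1, IsUnit (1 + t • (N - 1))) :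
    ∃ C : ℝ, ∀ᶠ M in 𝓝 N, ∀ t ∈ Icc (0 : ℝ) 1,
      IsUnit (1 + t • (M - 1)) ∧ ‖Ring.inverse (1 + t • (M - 1))‖ ≤ C := by
  have hcont : ∀ t ∈ Icc (0 : ℝ) 1,
      ContinuousAt (fun p : 𝔸 × ℝ => Ring.inverse (1 + p.2 • (p.1 - 1))) (N, t) := by
    intro t ht
    obtain ⟨u, hu⟩ := hN t ht
    have h2 : ContinuousAt Ring.inverse (1 + t • (N - 1)) := by
      rw [← hu]; exact NormedRing.inverse_continuousAt u
    exact ContinuousAt.comp (x := (N, t)) (f := fun p : 𝔸 × ℝ => 1 + p.2 • (p.1 - 1)) h2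
      (by fun_prop)
  have hcN : ContinuousOn (fun t : ℝ => Ring.inverse (1 + t • (N - 1))) (Icc 0 1) := by
    intro t ht
    exact (ContinuousAt.comp (f := fun t : ℝ => (N, t)) (hcont t ht)
      (by fun_prop)).continuousWithinAt
  obtain ⟨C, hC⟩ := isCompact_Icc.exists_bound_of_continuousOn hcN
  refine ⟨C + 1, isCompact_Icc.eventually_forall_of_forall_eventually fun t ht => ?_⟩
  have h1 : ∀ᶠ p : 𝔸 × ℝ in 𝓝 (N, t), IsUnit (1 + p.2 • (p.1 - 1)) := by
    have hc : ContinuousAt (fun p : 𝔸 × ℝ => 1 + p.2 • (p.1 - 1)) (N, t) := by fun_prop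
    obtain ⟨u, hu⟩ := hN t ht
    refine hc.eventually ?_
    simp only [← hu]
    exact Units.nhds u
  have h2 : ∀ᶠ p : 𝔸 × ℝ in 𝓝 (N, t), ‖Ring.inverse (1 + p.2 • (p.1 - 1))‖ < C + 1 :=
    (hcont t ht).norm.eventually (gt_mem_nhds (lt_of_le_of_lt (hC t ht) (by linarith)))
  filter_upwards [h1, h2] with p hp1 hp2 using ⟨hp1, hp2.le⟩

/-- Adding a scalar to a logarithm scales the exponential. -/
theorem exp_algebraMap_add (z : ℂ) (G : 𝔸) :
    NormedSpace.exp (algebraMap ℂ 𝔸 z + G) = Complex.exp z • NormedSpace.exp G := by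
  rw [exp_add_of_commute_complex (Algebra.commutes z G), ← NormedSpace.algebraMap_exp_comm,
    ← Complex.exp_eq_exp_ℂ, Algebra.smul_def]

end BanachAlgebraLog

/-! ### The matrix logarithm -/

section MatrixLog

variable {n : ℕ}

/-- Some closed ray from the origin avoids the finite spectrum of an invertible matrix; it serves as
the branch cut of a logarithm. -/
theorem exists_ray_disjoint_spectrum (M : Matrix (Fin n) (Fin n) ℂ) (hM : IsUnit M) :
    ∃ φ : ℝ, ∀ r : ℝ, 0 ≤ r → -(r : ℂ) * Complex.exp (φ * Complex.I) ∉ spectrum ℂ M := by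
  have hfin : ((fun z : ℂ => Complex.arg (-z)) '' spectrum ℂ M).Finite :=
    (Matrix.finite_spectrum M).image _
  obtain ⟨φ, hφ, hφ'⟩ := ((Ioc_infinite (by linarith [Real.pi_pos] : -Real.pi < Real.pi)).sdiff
    hfin).nonempty
  refine ⟨φ, fun r hr hs => ?_⟩
  rcases hr.eq_or_lt with rfl | hr
  · simp only [Complex.ofReal_zero, neg_zero, zero_mul] at hs
    exact (spectrum.zero_notMem_iff ℂ).2 hM hs
  · refine hφ' ⟨_, hs, ?_⟩
    simp only [neg_mul, neg_neg]
    rw [Complex.exp_mul_I, Complex.arg_mul_cos_add_sin_mul_I hr hφ]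

/-- After rotating the branch cut to the negative real axis, the segment from `1` to the matrix
consists of units. -/
theorem exists_eventually_bounded_log (M : Matrix (Fin n) (Fin n) ℂ) (hM : IsUnit M) :
    ∃ C : ℝ, ∀ᶠ N in 𝓝 M, ∃ G, NormedSpace.exp G = N ∧ ‖G‖ ≤ C := by
  obtain ⟨φ, hφ⟩ := exists_ray_disjoint_spectrum M hM
  set u : ℂ := Complex.exp (φ * Complex.I) with hu
  have hu0 : u ≠ 0 := Complex.exp_ne_zero _
  have hunit : ∀ t ∈ Icc (0 : ℝ) 1, IsUnit (1 + t • (u⁻¹ • M - 1)) := by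
    intro t ht
    rcases ht.1.eq_or_lt with rfl | ht0
    · simp
    have hr : 0 ≤ (1 - t) / t := div_nonneg (by linarith [ht.2]) ht0.le
    have h1 := hφ _ hr
    rw [spectrum.notMem_iff] at h1
    have ht0' : (t : ℂ) ≠ 0 := by exact_mod_cast ht0.ne'
    have h2 : (1 + t • (u⁻¹ • M - 1)) = (-(t : ℂ) * u⁻¹) •
        (algebraMap ℂ (Matrix (Fin n) (Fin n) ℂ) (-(((1 - t) / t : ℝ) : ℂ) * u) - M) := by
      have h3 : -(t : ℂ) * u⁻¹ * (-(((1 - t) / t : ℝ) : ℂ) * u) = 1 - t := by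
        push_cast
        field_simp
      rw [Algebra.algebraMap_eq_smul_one, smul_sub (-(t : ℂ) * u⁻¹), smul_smul, h3,
        ← Complex.coe_smul t, smul_sub, smul_smul, sub_smul, one_smul, neg_mul, neg_smul]
      abel
    rw [h2]
    exact h1.smul (Units.mk0 (-(t : ℂ) * u⁻¹)
      (mul_ne_zero (neg_ne_zero.2 ht0') (inv_ne_zero hu0)))
  obtain ⟨C, hC⟩ := eventually_segment_bound hunit
  have hcont : ContinuousAt (fun N : Matrix (Fin n) (Fin n) ℂ => u⁻¹ • N) M := by fun_prop
  refine ⟨‖algebraMap ℂ (Matrix (Fin n) (Fin n) ℂ) (φ * Complex.I)‖ +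
    C * (‖u⁻¹ • M - 1‖ + 1), ?_⟩
  have hnear : ∀ᶠ N in 𝓝 M, ‖u⁻¹ • N - 1‖ < ‖u⁻¹ • M - 1‖ + 1 :=
    (hcont.sub continuousAt_const).norm.eventually (gt_mem_nhds (lt_add_one _))
  filter_upwards [hcont.eventually hC, hnear] with N hN hN'
  obtain ⟨G, hG, hGn⟩ := exists_exp_eq_of_segment hN
  refine ⟨algebraMap ℂ _ (φ * Complex.I) + G, ?_, (norm_add_le _ _).trans ?_⟩
  · rw [exp_algebraMap_add, hG, ← hu, smul_smul, mul_inv_cancel₀ hu0, one_smul]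
  · have hC0 : 0 ≤ C := (norm_nonneg _).trans (hN 0 (by simp)).2
    gcongr
    exact hGn.trans (by gcongr)

/-- The logarithm of least norm is a matrix logarithm. -/
theorem exists_isMatrixLog (n : ℕ) : ∃ L, IsMatrixLog n L := by
  have hne : ∀ M : Matrix (Fin n) (Fin n) ℂ, IsUnit M → ∃ X, NormedSpace.exp X = M ∧
      ∀ Y, NormedSpace.exp Y = M → ‖X‖ ≤ ‖Y‖ := by
    intro M hM
    obtain ⟨C, hC⟩ := exists_eventually_bounded_log M hM
    obtain ⟨G, hG, -⟩ := hC.self_of_nhds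
    let _ := NormedAlgebra.restrictScalars ℚ ℂ (Matrix (Fin n) (Fin n) ℂ)
    have hcl : IsClosed {X : Matrix (Fin n) (Fin n) ℂ | NormedSpace.exp X = M} :=
      isClosed_eq NormedSpace.exp_continuous continuous_const
    have : ProperSpace (Matrix (Fin n) (Fin n) ℂ) := FiniteDimensional.proper ℂ _
    obtain ⟨X, hX, hXd⟩ := hcl.exists_infDist_eq_dist ⟨G, hG⟩ 0
    refine ⟨X, hX, fun Y hY => ?_⟩
    have := Metric.infDist_le_dist_of_mem (x := 0) (show Y ∈ {X | NormedSpace.exp X = M} from hY)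
    rwa [hXd, dist_zero_left, dist_zero_left] at this
  choose! L hL hLmin using hne
  refine ⟨L, hL, fun R => ?_, ?_⟩
  · have : ProperSpace (Matrix (Fin n) (Fin n) ℂ) := FiniteDimensional.proper ℂ _
    -- The set in question is the projection of a compact set of pairs of mutually inverse matrices.
    set S : Set (Matrix (Fin n) (Fin n) ℂ × Matrix (Fin n) (Fin n) ℂ) :=
      (Metric.closedBall 0 R ×ˢ Metric.closedBall 0 R) ∩ {p | p.1 * p.2 = 1} with hS
    have hSc : IsCompact S :=
      ((isCompact_closedBall _ _).prod (isCompact_closedBall _ _)).inter_right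
        (isClosed_eq (by fun_prop) continuous_const)
    have hSi : IsCompact (Prod.fst '' S) := hSc.image continuous_fst
    have hu : ∀ M ∈ Prod.fst '' S, IsUnit M := by
      rintro _ ⟨p, hp, rfl⟩
      exact IsUnit.of_mul_eq_one _ hp.2
    have hloc : ∀ M ∈ Prod.fst '' S, ∃ t ∈ 𝓝[Prod.fst '' S] M, ∃ C : ℝ, ∀ N ∈ t, IsUnit N →
        ‖L N‖ ≤ C := by
      intro M hM
      obtain ⟨C, hC⟩ := exists_eventually_bounded_log M (hu M hM)
      refine ⟨_, mem_nhdsWithin_of_mem_nhds hC, C, ?_⟩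
      rintro N ⟨G, hG, hGC⟩ hN
      exact (hLmin N hN G hG).trans hGC
    obtain ⟨K, hK⟩ := hSi.induction_on (p := fun t => ∃ C : ℝ, ∀ N ∈ t, IsUnit N → ‖L N‖ ≤ C)
      ⟨0, by simp⟩ (fun s t hst ⟨C, hC⟩ => ⟨C, fun N hN => hC N (hst hN)⟩)
      (fun s t ⟨C, hC⟩ ⟨D, hD⟩ => ⟨max C D, fun N hN hNu => hN.elim
        (fun h => (hC N h hNu).trans (le_max_left _ _))
        (fun h => (hD N h hNu).trans (le_max_right _ _))⟩) hloc
    refine ⟨K, fun M hM h1 h2 => hK M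
      ⟨(M, M⁻¹), ⟨⟨by simpa using h1, by simpa using h2⟩, ?_⟩, rfl⟩ hM⟩
    exact Matrix.mul_nonsing_inv M ((Matrix.isUnit_iff_isUnit_det M).1 hM)
  · -- `exp` is open at `0`, so matrices near `1` have logarithms of small norm.
    have hmap : map NormedSpace.exp (𝓝 (0 : Matrix (Fin n) (Fin n) ℂ)) = 𝓝 1 := by
      have := (hasStrictFDerivAt_exp_zero (𝕂 := ℂ)
        (𝔸 := Matrix (Fin n) (Fin n) ℂ)).map_nhds_eq_of_surj
        (LinearMap.range_eq_top.2 fun x => ⟨x, rfl⟩)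
      rwa [NormedSpace.exp_zero] at this
    have hunits : ∀ᶠ M in 𝓝 (1 : Matrix (Fin n) (Fin n) ℂ), IsUnit M := Units.nhds 1
    rw [Metric.tendsto_nhds]
    intro ε hε
    have h1 : NormedSpace.exp '' Metric.ball 0 ε ∈ 𝓝 (1 : Matrix (Fin n) (Fin n) ℂ) := by
      rw [← hmap]; exact image_mem_map (Metric.ball_mem_nhds _ hε)
    filter_upwards [hunits, h1] with M hM ⟨X, hX, hXM⟩
    rw [dist_zero_right]
    exact (hLmin M hM X hXM).trans_lt (by simpa using hX)

namespace IsMatrixLog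

variable {L : Matrix (Fin n) (Fin n) ℂ → Matrix (Fin n) (Fin n) ℂ}

/-- Every matrix logarithm agrees to first order with `M - 1` at `M = 1`. -/
theorem isLittleO_near_one (hL : IsMatrixLog n L) :
    (fun M => L M - (M - 1)) =o[𝓝 1] fun M => M - 1 := by
  have h0 : HasFDerivAt (NormedSpace.exp : Matrix (Fin n) (Fin n) ℂ → _)
      (1 : Matrix (Fin n) (Fin n) ℂ →L[ℂ] _) 0 := hasFDerivAt_exp_zero
  have h1 := (hasFDerivAt_iff_isLittleO_nhds_zero.1 h0).comp_tendsto hL.near_one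
  have hunits : ∀ᶠ M in 𝓝 (1 : Matrix (Fin n) (Fin n) ℂ), IsUnit M := Units.nhds 1
  have h2 : Asymptotics.IsEquivalent (𝓝 1) (fun M : Matrix (Fin n) (Fin n) ℂ => M - 1) L := by
    refine h1.congr' ?_ EventuallyEq.rfl
    filter_upwards [hunits] with M hM
    simp [hL.exp_log M hM]
  exact h2.symm

/-- The coefficient `log (1 + m X) / log (1 + m)` tends to `X` as `m` decreases to `0`, uniformly
for `X` in a ball. -/
theorem norm_log_smul_sub_le (hL : IsMatrixLog n L) (R : ℝ) {ε : ℝ} (hε : 0 < ε) :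
    ∃ δ > 0, ∀ m : ℝ, 0 < m → m < δ → ∀ X : Matrix (Fin n) (Fin n) ℂ, ‖X‖ ≤ R →
      ‖(Real.log (1 + m))⁻¹ • L (1 + m • X) - X‖ ≤ ε := by
  -- `R'` is a positive bound, also when `R` is not.
  set R' := |R| + 1 with hR'
  have hR'0 : 0 < R' := by positivity
  have h1 := hL.isLittleO_near_one.def (show 0 < ε / (4 * R') by positivity)
  obtain ⟨ρ, hρ, hρ'⟩ := Metric.eventually_nhds_iff.1 h1
  have hlog : Tendsto (fun m : ℝ => m / Real.log (1 + m)) (𝓝[>] 0) (𝓝 1) := by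
    have hd : HasDerivAt (fun m : ℝ => Real.log (1 + m)) 1 0 := by
      simpa using ((hasDerivAt_id (0 : ℝ)).const_add 1).log (by simp)
    have := (hasDerivAt_iff_tendsto_slope.1 hd).mono_left
      (nhdsWithin_mono 0 (fun x (hx : (0 : ℝ) < x) => (ne_of_gt hx : x ≠ 0)))
    have := this.inv₀ one_ne_zero
    simp only [inv_one] at this
    refine this.congr fun m => ?_
    simp [slope_def_field]
  have hev : ∀ᶠ m : ℝ in 𝓝[>] 0, |m / Real.log (1 + m) - 1| < min 1 (ε / (2 * R')) := by
    have := Metric.tendsto_nhds.1 hlog (min 1 (ε / (2 * R'))) (by positivity)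
    simpa only [Real.dist_eq] using this
  obtain ⟨δ, hδ, hδ'⟩ := mem_nhdsGT_iff_exists_Ioo_subset.1 hev
  refine ⟨min δ (ρ / R'), lt_min hδ (by positivity), fun m hm hmδ X hX => ?_⟩
  have hXR : ‖X‖ ≤ R' := hX.trans ((le_abs_self R).trans (by simp [hR']))
  have hmX : ‖m • X‖ ≤ m * R' := by
    rw [norm_smul, Real.norm_of_nonneg hm.le]; gcongr
  have hmd := hδ' ⟨hm, hmδ.trans_le (min_le_left _ _)⟩
  simp only [mem_ofPred_eq, lt_min_iff] at hmd
  set r := m / Real.log (1 + m) with hr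
  have hr2 : |r| ≤ 2 := by
    have := abs_lt.1 hmd.1
    rw [abs_le]; constructor <;> linarith
  have h2 : ‖L (1 + m • X) - m • X‖ ≤ ε / (4 * R') * (m * R') := by
    have := hρ' (y := 1 + m • X) (by
      rw [dist_eq_norm, add_sub_cancel_left]
      refine hmX.trans_lt ?_
      have := hmδ.trans_le (min_le_right _ _)
      rwa [lt_div_iff₀ hR'0] at this)
    rw [add_sub_cancel_left] at this
    exact this.trans (by gcongr)
  have h3 : (Real.log (1 + m))⁻¹ • L (1 + m • X) - X =
      (r * m⁻¹) • (L (1 + m • X) - m • X) + (r - 1) • X := by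
    have : (Real.log (1 + m))⁻¹ = r * m⁻¹ := by
      rw [hr]; field_simp
    rw [this, smul_sub, smul_smul, mul_assoc, inv_mul_cancel₀ hm.ne', mul_one, sub_smul, one_smul]
    abel
  rw [h3]
  calc ‖(r * m⁻¹) • (L (1 + m • X) - m • X) + (r - 1) • X‖
      ≤ |r| * m⁻¹ * (ε / (4 * R') * (m * R')) + (ε / (2 * R')) * R' := by
        refine (norm_add_le _ _).trans (add_le_add ?_ ?_)
        · rw [norm_smul, Real.norm_eq_abs, abs_mul, abs_of_pos (inv_pos.2 hm)]
          gcongr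
        · rw [norm_smul, Real.norm_eq_abs]
          exact mul_le_mul hmd.2.le hXR (norm_nonneg _) (by positivity)
    _ ≤ 2 * m⁻¹ * (ε / (4 * R') * (m * R')) + (ε / (2 * R')) * R' := by gcongr
    _ = ε := by field_simp; ring

end IsMatrixLog

end MatrixLog

/-! ### Linear differential equations with bounded measurable coefficient -/

section LinearODE

/-- The integral equation `Φ t = 1 + ∫₀ᵗ B Φ` is solved by contraction in the norm
`sup ‖e^{-ct} Φ t‖`. -/
theorem exists_continuous_solution {𝔸 : Type*} [NormedRing 𝔸] [NormedAlgebra ℝ 𝔸] [CompleteSpace 𝔸]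
    {B : ℝ → 𝔸} {K : ℝ} (hB : ∀ t, ‖B t‖ ≤ K) (hBi : ∀ a b, IntervalIntegrable B volume a b) :
    ∃ Φ : ℝ → 𝔸, Continuous Φ ∧ ∀ t, 0 ≤ t → Φ t = 1 + ∫ s in (0 : ℝ)..t, B s * Φ s := by
  have hK : 0 ≤ K := (norm_nonneg _).trans (hB 0)
  set c : ℝ := 2 * K + 1 with hc
  have hc0 : 0 < c := by positivity
  have hint : ∀ Y : ℝ → 𝔸, Continuous Y → ∀ a b,
      IntervalIntegrable (fun s => B s * (Real.exp (c * s) • Y s)) volume a b := fun Y hY a b =>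
    (hBi a b).mul_continuousOn (Continuous.continuousOn (by fun_prop))
  set I : (ℝ → 𝔸) → ℝ → 𝔸 := fun Y t =>
    Real.exp (-(c * max t 0)) • ∫ s in (0 : ℝ)..max t 0, B s * (Real.exp (c * s) • Y s) with hI
  have hIc : ∀ Y : ℝ → 𝔸, Continuous Y → Continuous (I Y) := by
    intro Y hY
    have := intervalIntegral.continuous_primitive (hint Y hY) 0
    exact (by fun_prop : Continuous fun t : ℝ => Real.exp (-(c * max t 0))).smul
      (this.comp (by fun_prop : Continuous fun t : ℝ => max t 0))
  have hIb : ∀ (Y : ℝ → 𝔸) (C : ℝ), (∀ t, ‖Y t‖ ≤ C) → ∀ t, ‖I Y t‖ ≤ C / 2 := by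
    intro Y C hY t
    have hC : 0 ≤ C := (norm_nonneg _).trans (hY 0)
    have h1 : ‖∫ s in (0 : ℝ)..max t 0, B s * (Real.exp (c * s) • Y s)‖ ≤
        ∫ s in (0 : ℝ)..max t 0, K * C * Real.exp (c * s) := by
      refine intervalIntegral.norm_integral_le_of_norm_le (le_max_right _ _)
        (Eventually.of_forall fun s _ => ?_)
        (Continuous.intervalIntegrable (by fun_prop) _ _)
      refine (norm_mul_le _ _).trans ?_
      rw [norm_smul, Real.norm_of_nonneg (Real.exp_pos _).le]
      calc ‖B s‖ * (Real.exp (c * s) * ‖Y s‖) ≤ K * (Real.exp (c * s) * C) := by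
            gcongr
            exacts [hB s, hY s]
        _ = K * C * Real.exp (c * s) := by ring
    have h2 : ∫ s in (0 : ℝ)..max t 0, K * C * Real.exp (c * s) =
        K * C * ((Real.exp (c * max t 0) - 1) / c) := by
      rw [intervalIntegral.integral_const_mul, intervalIntegral.integral_comp_mul_left _ hc0.ne',
        integral_exp]
      simp [div_eq_inv_mul]
    rw [hI]
    simp only
    rw [norm_smul, Real.norm_of_nonneg (Real.exp_pos _).le]
    calc Real.exp (-(c * max t 0)) * ‖∫ s in (0 : ℝ)..max t 0, B s * (Real.exp (c * s) • Y s)‖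
        ≤ Real.exp (-(c * max t 0)) * (K * C * (Real.exp (c * max t 0) / c)) := by
          gcongr
          refine h1.trans ?_
          rw [h2]
          gcongr
          linarith
      _ = K * C / c := by
          rw [Real.exp_neg]; field_simp
      _ ≤ C / 2 := by
          rw [div_le_div_iff₀ hc0 two_pos]
          nlinarith
  set F : BoundedContinuousFunction ℝ 𝔸 → BoundedContinuousFunction ℝ 𝔸 := fun Y =>
    BoundedContinuousFunction.ofNormedAddCommGroup
      (fun t => Real.exp (-(c * max t 0)) • (1 : 𝔸) + I Y t)
      ((by fun_prop : Continuous fun t : ℝ => Real.exp (-(c * max t 0)) • (1 : 𝔸)).add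
        (hIc Y Y.continuous)) (‖(1 : 𝔸)‖ + ‖Y‖ / 2) (fun t => by
          refine (norm_add_le _ _).trans (add_le_add ?_ (hIb Y _ Y.norm_coe_le_norm t))
          rw [norm_smul, Real.norm_of_nonneg (Real.exp_pos _).le]
          refine mul_le_of_le_one_left (norm_nonneg _) (Real.exp_le_one_iff.2 ?_)
          have : 0 ≤ max t 0 := le_max_right _ _
          nlinarith) with hF
  have hFc : ContractingWith (1 / 2 : NNReal) F := by
    refine ⟨by rw [← NNReal.coe_lt_coe]; norm_num, LipschitzWith.of_dist_le_mul fun Y Z => ?_⟩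
    rw [BoundedContinuousFunction.dist_le (by positivity)]
    intro t
    have h1 : F Y t - F Z t = I (fun t => Y t - Z t) t := by
      simp only [hF, BoundedContinuousFunction.coe_ofNormedAddCommGroup, hI,
        add_sub_add_left_eq_sub, ← smul_sub]
      rw [← intervalIntegral.integral_sub (hint Y Y.continuous _ _) (hint Z Z.continuous _ _)]
      simp only [← mul_sub, ← smul_sub]
    rw [dist_eq_norm, h1]
    have := hIb (fun t => Y t - Z t) (dist Y Z) (fun t => by
      rw [← dist_eq_norm]; exact BoundedContinuousFunction.dist_coe_le_dist t) t
    refine this.trans_eq ?_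
    simp only [NNReal.coe_div, NNReal.coe_one, NNReal.coe_ofNat]
    ring
  obtain ⟨Y, hY⟩ : ∃ Y, F Y = Y := ⟨_, hFc.fixedPoint_isFixedPt⟩
  refine ⟨fun t => Real.exp (c * t) • Y t, by fun_prop, fun t ht => ?_⟩
  have h1 : Y t = Real.exp (-(c * t)) • (1 : 𝔸) + I Y t := by
    have := congrArg (fun Z : BoundedContinuousFunction ℝ 𝔸 => Z t) hY
    simp only [hF, BoundedContinuousFunction.coe_ofNormedAddCommGroup, max_eq_left ht] at this
    exact this.symm
  have h2 : I Y t = Real.exp (-(c * t)) • ∫ s in (0 : ℝ)..t, B s * (Real.exp (c * s) • Y s) := by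
    simp only [hI, max_eq_left ht]
  simp only
  rw [h1, h2, ← smul_add, smul_smul, ← Real.exp_add, add_neg_cancel, Real.exp_zero, one_smul]

/-- The integral form of Grönwall's inequality. -/
theorem le_mul_exp_of_le_add_integral {φ : ℝ → ℝ} (hφ : Continuous φ) {K δ a b : ℝ} (hK : 0 ≤ K)
    (h : ∀ r ∈ Icc a b, φ r ≤ δ + K * ∫ s in a..r, φ s) (hab : a ≤ b) :
    φ b ≤ δ * Real.exp (K * (b - a)) := by
  have hd : ∀ r, HasDerivAt (fun r => δ + K * ∫ s in a..r, φ s) (K * φ r) r := fun r =>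
    ((intervalIntegral.integral_hasDerivAt_right (hφ.intervalIntegrable _ _)
      (hφ.stronglyMeasurableAtFilter _ _) hφ.continuousAt).const_mul K).const_add δ
  have := le_gronwallBound_of_liminf_deriv_right_le (f := fun r => δ + K * ∫ s in a..r, φ s)
    (f' := fun r => K * φ r) (δ := δ) (K := K) (ε := 0) (a := a) (b := b)
    (fun r _ => (hd r).continuousAt.continuousWithinAt)
    (fun r _ q hq => ((hd r).hasDerivWithinAt (s := Ici r)).liminf_right_slope_le hq)
    (by simp) (fun r hr => by
      rw [add_zero]; exact mul_le_mul_of_nonneg_left (h r (Ico_subset_Icc_self hr)) hK)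
    b ⟨hab, le_rfl⟩
  rw [gronwallBound_ε0] at this
  exact (h b ⟨hab, le_rfl⟩).trans this

variable {E : Type*} [NormedAddCommGroup E]

/-- A solution of a linear equation whose coefficient is bounded by `K` grows or decays at most
like `e^{K|v - u|}`. -/
theorem norm_le_exp_mul_norm {x : ℝ → E} (hx : Continuous x) {K : ℝ} (hK : 0 ≤ K)
    (h : ∀ u v, 0 ≤ u → u ≤ v → ‖x v - x u‖ ≤ K * ∫ s in u..v, ‖x s‖) {u v : ℝ}
    (hu : 0 ≤ u) (hv : 0 ≤ v) : ‖x v‖ ≤ Real.exp (K * |v - u|) * ‖x u‖ := by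
  rcases le_total u v with huv | hvu
  · rw [abs_of_nonneg (by linarith), mul_comm]
    refine le_mul_exp_of_le_add_integral hx.norm hK (fun r hr => ?_) huv
    have h1 := h u r hu hr.1
    have h2 := norm_le_norm_add_norm_sub (x u) (x r)
    rw [norm_sub_rev] at h1
    linarith
  · rw [abs_of_nonpos (by linarith), mul_comm]
    have := le_mul_exp_of_le_add_integral (φ := fun r => ‖x (-r)‖) (by fun_prop) (δ := ‖x u‖)
      (a := -u) (b := -v) hK (fun r hr => ?_) (by linarith)
    · simp only [neg_neg] at this
      convert this using 3
      ring
    · have h1 := h (-r) u (by linarith [hr.2]) (by linarith [hr.1])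
      have h2 := norm_le_norm_add_norm_sub (x u) (x (-r))
      have h3 : ∫ s in (-u)..r, ‖x (-s)‖ = ∫ s in (-r)..u, ‖x s‖ := by
        rw [intervalIntegral.integral_comp_neg (fun s => ‖x s‖), neg_neg]
      rw [h3]
      linarith

variable {𝔸 : Type*} [NormedRing 𝔸] [NormedAlgebra ℝ 𝔸]

theorem solution_sub {B Φ : ℝ → 𝔸} (hΦ : Continuous Φ)
    (hBi : ∀ a b, IntervalIntegrable B volume a b)
    (h : ∀ t, 0 ≤ t → Φ t = 1 + ∫ s in (0 : ℝ)..t, B s * Φ s) {u v : ℝ} (hu : 0 ≤ u)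
    (hv : 0 ≤ v) : Φ v - Φ u = ∫ s in u..v, B s * Φ s := by
  have hi : ∀ a b, IntervalIntegrable (fun s => B s * Φ s) volume a b := fun a b =>
    (hBi a b).mul_continuousOn hΦ.continuousOn
  rw [h v hv, h u hu, add_sub_add_left_eq_sub, intervalIntegral.integral_interval_sub_left
    (hi _ _) (hi _ _)]

theorem norm_solution_mul_le [CompleteSpace 𝔸] {B Φ : ℝ → 𝔸} {K : ℝ} (hΦ : Continuous Φ)
    (hB : ∀ t, ‖B t‖ ≤ K)
    (hBi : ∀ a b, IntervalIntegrable B volume a b)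
    (h : ∀ t, 0 ≤ t → Φ t = 1 + ∫ s in (0 : ℝ)..t, B s * Φ s) (ζ : 𝔸) {u v : ℝ} (hu : 0 ≤ u)
    (hv : 0 ≤ v) : ‖Φ v * ζ‖ ≤ Real.exp (K * |v - u|) * ‖Φ u * ζ‖ := by
  have hK : 0 ≤ K := (norm_nonneg _).trans (hB 0)
  refine norm_le_exp_mul_norm (x := fun t => Φ t * ζ) (by fun_prop) hK (fun u v hu huv => ?_) hu hv
  have hi : IntervalIntegrable (fun s => B s * Φ s) volume u v :=
    (hBi u v).mul_continuousOn hΦ.continuousOn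
  rw [← sub_mul, solution_sub hΦ hBi h hu (hu.trans huv)]
  have h1 := ((ContinuousLinearMap.mul ℝ 𝔸).flip ζ).intervalIntegral_comp_comm hi
  simp only [ContinuousLinearMap.flip_apply, ContinuousLinearMap.mul_apply'] at h1
  rw [← h1, ← intervalIntegral.integral_const_mul]
  refine intervalIntegral.norm_integral_le_of_norm_le huv
    (Eventually.of_forall fun s _ => ?_) (Continuous.intervalIntegrable (by fun_prop) _ _)
  rw [mul_assoc]
  exact (norm_mul_le _ _).trans (by gcongr; exact hB s)

/-- In a finite-dimensional algebra the fundamental solution is invertible: left multiplication by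
it is injective by the lower growth bound. -/
theorem isUnit_solution [FiniteDimensional ℝ 𝔸] {B Φ : ℝ → 𝔸} {K : ℝ} (hΦ : Continuous Φ)
    (hB : ∀ t, ‖B t‖ ≤ K) (hBi : ∀ a b, IntervalIntegrable B volume a b)
    (h : ∀ t, 0 ≤ t → Φ t = 1 + ∫ s in (0 : ℝ)..t, B s * Φ s) {v : ℝ} (hv : 0 ≤ v) :
    IsUnit (Φ v) := by
  have : CompleteSpace 𝔸 := FiniteDimensional.complete ℝ 𝔸
  have h0 : Φ 0 = 1 := by simpa using h 0 le_rfl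
  have hinj : Function.Injective (LinearMap.mulLeft ℝ (Φ v)) := by
    rw [← LinearMap.ker_eq_bot, LinearMap.ker_eq_bot']
    intro ζ hζ
    have := norm_solution_mul_le hΦ hB hBi h ζ hv le_rfl
    rw [LinearMap.mulLeft_apply] at hζ
    rw [hζ, h0, one_mul, norm_zero, mul_zero] at this
    exact norm_le_zero_iff.1 this
  obtain ⟨ζ, hζ⟩ := LinearMap.injective_iff_surjective.1 hinj 1
  rw [LinearMap.mulLeft_apply] at hζ
  have h1 : ζ * Φ v = 1 := hinj (by
    rw [LinearMap.mulLeft_apply, LinearMap.mulLeft_apply, ← mul_assoc, hζ, one_mul, mul_one])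
  exact ⟨⟨Φ v, ζ, hζ, h1⟩, rfl⟩

/-- On an interval where the coefficient is constant the solution is an exponential. -/
theorem solution_eq_exp_mul {𝔸 : Type*} [NormedRing 𝔸] [NormedAlgebra ℂ 𝔸] [CompleteSpace 𝔸]
    {B Φ : ℝ → 𝔸} (hΦ : Continuous Φ) {u v : ℝ} {X : 𝔸} (huv : u ≤ v)
    (h : ∀ r ∈ Icc u v, Φ r - Φ u = ∫ s in u..r, B s * Φ s) (hX : ∀ s ∈ Ioo u v, B s = X) :
    Φ v = NormedSpace.exp ((v - u) • X) * Φ u := by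
  set Ψ : ℝ → 𝔸 := fun r => Φ u + ∫ s in u..r, X * Φ s with hΨ
  have hcont : Continuous fun s => X * Φ s := by fun_prop
  have hΨΦ : ∀ r ∈ Icc u v, Ψ r = Φ r := by
    intro r hr
    have h1 : ∫ s in u..r, X * Φ s = ∫ s in u..r, B s * Φ s := by
      refine intervalIntegral.integral_congr_ae ?_
      have : ∀ᵐ s : ℝ, s ≠ r := Measure.ae_ne volume r
      filter_upwards [this] with s hs hs'
      rw [uIoc_of_le hr.1] at hs'
      rw [hX s ⟨hs'.1, (lt_of_le_of_ne hs'.2 hs).trans_le hr.2⟩]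
    simp only [hΨ]
    rw [h1, ← h r hr, add_sub_cancel]
  have hΨd : ∀ r, HasDerivAt Ψ (X * Φ r) r := fun r =>
    (intervalIntegral.integral_hasDerivAt_right (hcont.intervalIntegrable _ _)
      (hcont.stronglyMeasurableAtFilter _ _) hcont.continuousAt).const_add _
  have hEd : ∀ r, HasDerivAt (fun r : ℝ => NormedSpace.exp ((r - u) • (-X)))
      (NormedSpace.exp ((r - u) • (-X)) * (-X)) r := by
    intro r
    have h1 := hasDerivAt_exp_smul_const (𝕂 := ℝ) (-X) (r - u)
    have h2 : HasDerivAt (fun r : ℝ => r - u) 1 r := (hasDerivAt_id r).sub_const u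
    have := h1.scomp r h2
    rw [one_smul] at this
    exact this
  have hF : ∀ r ∈ Icc u v, HasDerivAt (fun r => NormedSpace.exp ((r - u) • (-X)) * Ψ r) 0 r := by
    intro r hr
    refine ((hEd r).mul (hΨd r)).congr_deriv ?_
    rw [hΨΦ r hr]
    noncomm_ring
  have hconst := constant_of_has_deriv_right_zero (a := u) (b := v)
    (fun r hr => (hF r hr).continuousAt.continuousWithinAt)
    (fun r hr => (hF r (Ico_subset_Icc_self hr)).hasDerivWithinAt) v ⟨huv, le_rfl⟩
  simp only [sub_self, zero_smul, NormedSpace.exp_zero, one_mul] at hconst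
  rw [hΨΦ v ⟨huv, le_rfl⟩, hΨΦ u ⟨le_rfl, huv⟩] at hconst
  rw [← hconst, ← mul_assoc, smul_neg, ← exp_add_of_commute_complex
    (Commute.refl ((v - u) • X)).neg_right, add_neg_cancel, NormedSpace.exp_zero, one_mul]

end LinearODE

/-! ### Exponential dichotomy of linear difference equations -/

section DifferenceEquation

theorem pow_mul_le_of_sum_Ico_le_right {p : ℕ → ℝ} {θ : ℝ} (hθ : 0 < θ)
    {m : ℕ} (h : ∀ k, m < k → ∑ j ∈ Finset.Ico m k, p j ≤ θ * p k) (hp : ∀ j, 0 ≤ p j) {k : ℕ}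
    (hk : m ≤ k) : (1 + θ⁻¹) ^ (k - m) * p m ≤ (θ + 1) * p k := by
  rcases hk.eq_or_lt with rfl | hk
  · rw [Nat.sub_self, pow_zero, one_mul]
    nlinarith [hp m]
  have hS : ∀ k, m < k → (1 + θ⁻¹) ^ (k - m - 1) * p m ≤ ∑ j ∈ Finset.Ico m k, p j := by
    intro k hk
    induction k, hk using Nat.le_induction with
    | base => simp
    | succ k hk ih =>
      have hk' : m < k := hk
      rw [Finset.sum_Ico_succ_top hk'.le, show k + 1 - m - 1 = (k - m - 1) + 1 by omega, pow_succ]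
      have h1 : θ⁻¹ * ∑ j ∈ Finset.Ico m k, p j ≤ p k := by
        rw [inv_mul_le_iff₀ hθ]; exact h k hk'
      have h2 : (1 + θ⁻¹) * ((1 + θ⁻¹) ^ (k - m - 1) * p m) ≤
          (1 + θ⁻¹) * ∑ j ∈ Finset.Ico m k, p j := by gcongr
      nlinarith
  have h1 := (hS k hk).trans (h k hk)
  have h2 : (1 + θ⁻¹) ^ (k - m) = (1 + θ⁻¹) * (1 + θ⁻¹) ^ (k - m - 1) := by
    rw [← pow_succ']; congr 1; omega
  calc (1 + θ⁻¹) ^ (k - m) * p m = (1 + θ⁻¹) * ((1 + θ⁻¹) ^ (k - m - 1) * p m) := by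
        rw [h2]; ring
    _ ≤ (1 + θ⁻¹) * (θ * p k) := by gcongr
    _ = (θ + 1) * p k := by field_simp

theorem pow_mul_le_of_sum_Ico_le_left {p : ℕ → ℝ} {θ : ℝ} (hθ : 0 < θ)
    {m N : ℕ} (h : ∀ k, m ≤ k → k ≤ N → ∑ j ∈ Finset.Ico k (N + 1), p j ≤ θ * p k)
    (hp : ∀ j, 0 ≤ p j) (hmN : m ≤ N) : (1 + θ⁻¹) ^ (N - m) * p N ≤ θ * p m := by
  have hS : ∀ d k, m ≤ k → k + d = N →
      (1 + θ⁻¹) ^ d * p N ≤ ∑ j ∈ Finset.Ico k (N + 1), p j := by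
    intro d
    induction d with
    | zero => intro k _ hk; obtain rfl : k = N := by omega
              simp
    | succ d ih =>
      intro k hmk hk
      have h1 := ih (k + 1) (by omega) (by omega)
      have h2 := h k hmk (by omega)
      have h3 : ∑ j ∈ Finset.Ico k (N + 1), p j = p k + ∑ j ∈ Finset.Ico (k + 1) (N + 1), p j :=
        Finset.sum_eq_sum_Ico_succ_bot (by omega) _
      have h4 : θ⁻¹ * ∑ j ∈ Finset.Ico k (N + 1), p j ≤ p k := by
        rw [inv_mul_le_iff₀ hθ]; exact h2
      have h5 : θ⁻¹ * ∑ j ∈ Finset.Ico (k + 1) (N + 1), p j ≤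
          θ⁻¹ * ∑ j ∈ Finset.Ico k (N + 1), p j :=
        mul_le_mul_of_nonneg_left (by rw [h3]; linarith [hp k]) (inv_nonneg.2 hθ.le)
      rw [h3, pow_succ]
      have h6 : (1 + θ⁻¹) * ((1 + θ⁻¹) ^ d * p N) ≤
          (1 + θ⁻¹) * ∑ j ∈ Finset.Ico (k + 1) (N + 1), p j := by gcongr
      nlinarith
  exact (hS (N - m) m le_rfl (by omega)).trans (h m le_rfl hmN)

variable {E : Type*} [NormedAddCommGroup E] [NormedSpace ℂ E]

/-- The initial values of the bounded solutions of the homogeneous difference equation with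
fundamental solution `Φ`. -/
def boundedInitialValues (Φ : ℕ → E ≃L[ℂ] E) : Submodule ℂ E where
  carrier := {ξ | ∃ C : ℝ, ∀ k, ‖Φ k ξ‖ ≤ C}
  zero_mem' := ⟨0, by simp⟩
  add_mem' := by
    rintro a b ⟨C, hC⟩ ⟨D, hD⟩
    exact ⟨C + D, fun k => by
      rw [map_add]; exact (norm_add_le _ _).trans (add_le_add (hC k) (hD k))⟩
  smul_mem' := by
    rintro c a ⟨C, hC⟩
    exact ⟨‖c‖ * C, fun k => by
      rw [map_smul, norm_smul]; exact mul_le_mul_of_nonneg_left (hC k) (norm_nonneg _)⟩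

theorem eq_of_homogeneous {Φ : ℕ → E ≃L[ℂ] E} {d : ℕ → E}
    (hd : ∀ k, d (k + 1) = Φ (k + 1) ((Φ k).symm (d k))) (k : ℕ) :
    d k = Φ k ((Φ 0).symm (d 0)) := by
  induction k with
  | zero => simp
  | succ k ih => rw [hd, ih]; simp

/-- By the open mapping theorem, the bounded solution starting in a complement of the space of
bounded initial values is controlled by the right-hand side. -/
theorem exists_bound_of_solvable [CompleteSpace E] {Φ : ℕ → E ≃L[ℂ] E} {K : ℝ}
    (hK : ∀ k ξ, ‖Φ (k + 1) ξ‖ ≤ K * ‖Φ k ξ‖)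
    (hsol : ∀ g : ℕ → E, (∃ C : ℝ, ∀ k, ‖g k‖ ≤ C) → ∃ y : ℕ → E, (∃ C : ℝ, ∀ k, ‖y k‖ ≤ C) ∧
      ∀ k, y (k + 1) = Φ (k + 1) ((Φ k).symm (y k)) + g k)
    {W : Submodule ℂ E} (hW : IsCompl (boundedInitialValues Φ) W)
    (hWc : IsClosed (W : Set E)) :
    ∃ r > 0, ∀ (y g : ℕ → E) (G : ℝ), (∀ k, y (k + 1) = Φ (k + 1) ((Φ k).symm (y k)) + g k) →
      (∀ k, ‖g k‖ ≤ G) → (∃ C : ℝ, ∀ k, ‖y k‖ ≤ C) → (Φ 0).symm (y 0) ∈ W →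
      ∀ k, ‖y k‖ ≤ r * G := by
  have hM : ∀ k e, ‖Φ (k + 1) ((Φ k).symm e)‖ ≤ |K| * ‖e‖ := by
    intro k e
    have := hK k ((Φ k).symm e)
    rw [ContinuousLinearEquiv.apply_symm_apply] at this
    exact this.trans (by gcongr; exact le_abs_self K)
  let X : Submodule ℂ (BoundedContinuousFunction ℕ E) :=
    { carrier := {y | (Φ 0).symm (y 0) ∈ W}
      zero_mem' := by simp
      add_mem' := fun {a b} ha hb => by
        have := W.add_mem ha hb
        rw [← map_add] at this
        exact this
      smul_mem' := fun c a ha => by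
        have := W.smul_mem c ha
        rw [← map_smul] at this
        exact this }
  have hXc : IsClosed (X : Set (BoundedContinuousFunction ℕ E)) :=
    hWc.preimage ((Φ 0).symm.continuous.comp
      (continuous_eval_const (F := BoundedContinuousFunction ℕ E) 0))
  have : CompleteSpace X := hXc.completeSpace_coe
  have hDb : ∀ (y : BoundedContinuousFunction ℕ E) (k : ℕ),
      ‖y (k + 1) - Φ (k + 1) ((Φ k).symm (y k))‖ ≤ (1 + |K|) * ‖y‖ := by
    intro y k
    refine (norm_sub_le _ _).trans ?_
    have h1 := y.norm_coe_le_norm (k + 1)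
    have h2 := (hM k (y k)).trans
      (mul_le_mul_of_nonneg_left (y.norm_coe_le_norm k) (abs_nonneg K))
    linarith
  let Dfun : BoundedContinuousFunction ℕ E → BoundedContinuousFunction ℕ E := fun y =>
    BoundedContinuousFunction.ofNormedAddCommGroup
      (fun k => y (k + 1) - Φ (k + 1) ((Φ k).symm (y k))) continuous_of_discreteTopology
      ((1 + |K|) * ‖y‖) (hDb y)
  have hDfun : ∀ y k, Dfun y k = y (k + 1) - Φ (k + 1) ((Φ k).symm (y k)) := fun _ _ => rfl
  let D : X →L[ℂ] BoundedContinuousFunction ℕ E := LinearMap.mkContinuous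
    { toFun := fun y => Dfun y.1
      map_add' := fun a b => by
        ext k
        simp only [hDfun, BoundedContinuousFunction.coe_add, Pi.add_apply, Submodule.coe_add,
          map_add]
        abel
      map_smul' := fun c a => by
        ext k
        simp only [hDfun, BoundedContinuousFunction.coe_smul, Submodule.coe_smul, map_smul,
          smul_sub, RingHom.id_apply] }
    (1 + |K|) (fun y => BoundedContinuousFunction.norm_ofNormedAddCommGroup_le _ (by positivity)
      (hDb y.1))
  have hD : ∀ (y : X) k, D y k = y.1 (k + 1) - Φ (k + 1) ((Φ k).symm (y.1 k)) := fun _ _ => rfl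
  have hsurj : Function.Surjective D := by
    intro g
    obtain ⟨y, ⟨C, hC⟩, hy⟩ := hsol g ⟨‖g‖, g.norm_coe_le_norm⟩
    obtain ⟨a, ⟨Ca, hCa⟩, b, hb, hab⟩ := Submodule.mem_sup.1
      (hW.sup_eq_top ▸ Submodule.mem_top : (Φ 0).symm (y 0) ∈ boundedInitialValues Φ ⊔ W)
    let z : BoundedContinuousFunction ℕ E := BoundedContinuousFunction.ofNormedAddCommGroup
      (fun k => y k - Φ k a) continuous_of_discreteTopology (C + Ca)
      fun k => (norm_sub_le _ _).trans (add_le_add (hC k) (hCa k))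
    have hz : ∀ k, z k = y k - Φ k a := fun _ => rfl
    refine ⟨⟨z, ?_⟩, ?_⟩
    · change (Φ 0).symm (z 0) ∈ W
      rw [hz, map_sub, ContinuousLinearEquiv.symm_apply_apply, ← hab, add_sub_cancel_left]
      exact hb
    · ext k
      rw [hD]
      simp only [hz, hy k, map_sub, ContinuousLinearEquiv.symm_apply_apply]
      abel
  obtain ⟨r, hr, hpre⟩ := D.exists_preimage_norm_le hsurj
  refine ⟨r, hr, fun y g G hy hg ⟨C, hC⟩ hy0 k => ?_⟩
  have hG : 0 ≤ G := (norm_nonneg _).trans (hg 0)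
  let gb : BoundedContinuousFunction ℕ E := BoundedContinuousFunction.ofNormedAddCommGroup
    g continuous_of_discreteTopology G hg
  obtain ⟨z, hz, hzn⟩ := hpre gb
  have hzk : ∀ k, z.1 (k + 1) = Φ (k + 1) ((Φ k).symm (z.1 k)) + g k := by
    intro k
    have : D z k = g k := by rw [hz]; rfl
    rw [hD] at this
    rw [← this]; abel
  have hd := eq_of_homogeneous (Φ := Φ) (d := fun k => y k - z.1 k) (fun k => by
    simp only [hy k, hzk k, map_sub]; abel)
  have hd0 : (Φ 0).symm (y 0 - z.1 0) = 0 := by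
    have h1 : (Φ 0).symm (y 0 - z.1 0) ∈ W := by
      rw [map_sub]; exact W.sub_mem hy0 z.2
    have h2 : (Φ 0).symm (y 0 - z.1 0) ∈ boundedInitialValues Φ := by
      refine ⟨C + ‖z.1‖, fun k => ?_⟩
      rw [← hd k]
      exact (norm_sub_le _ _).trans (add_le_add (hC k) (z.1.norm_coe_le_norm k))
    exact Submodule.disjoint_def.1 hW.disjoint _ h2 h1
  have hyz : y k = z.1 k := by
    have := hd k
    simp only [hd0, map_zero] at this
    exact sub_eq_zero.1 this
  rw [hyz]
  calc ‖z.1 k‖ ≤ ‖z.1‖ := z.1.norm_coe_le_norm k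
    _ ≤ r * ‖gb‖ := hzn
    _ ≤ r * G := by
      gcongr
      exact BoundedContinuousFunction.norm_ofNormedAddCommGroup_le _ hG _

/-- Perron's theorem for difference equations on `ℕ`: if every bounded right-hand side admits a
bounded solution, the homogeneous equation has an exponential dichotomy. Solutions of the form
`c k • x k`, with `x` homogeneous and increments of `c` equal to `1 / ‖x k‖` on a window, bound the
sums of `1 / ‖x k‖` over the window by `1 / ‖x‖` at its end point, which forces exponential
growth or decay of `‖x k‖`. -/
theorem exists_dichotomy_of_solvable [FiniteDimensional ℂ E] {Φ : ℕ → E ≃L[ℂ] E} {K : ℝ}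
    (hK : ∀ k ξ, ‖Φ (k + 1) ξ‖ ≤ K * ‖Φ k ξ‖)
    (hsol : ∀ g : ℕ → E, (∃ C : ℝ, ∀ k, ‖g k‖ ≤ C) → ∃ y : ℕ → E, (∃ C : ℝ, ∀ k, ‖y k‖ ≤ C) ∧
      ∀ k, y (k + 1) = Φ (k + 1) ((Φ k).symm (y k)) + g k) :
    ∃ U V : Submodule ℂ E, IsCompl U V ∧ ∃ C > (0 : ℝ), ∃ lam > (0 : ℝ), ∀ m k : ℕ, m ≤ k →
      (∀ ξ ∈ U, ‖Φ k ξ‖ ≤ C * Real.exp (-lam * (k - m : ℝ)) * ‖Φ m ξ‖) ∧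
      (∀ ξ ∈ V, ‖Φ m ξ‖ ≤ C * Real.exp (-lam * (k - m : ℝ)) * ‖Φ k ξ‖) := by
  have : CompleteSpace E := FiniteDimensional.complete ℂ E
  obtain ⟨W, hW⟩ := Submodule.exists_isCompl (boundedInitialValues Φ)
  obtain ⟨r, hr, hbound⟩ := exists_bound_of_solvable hK hsol hW W.closed_of_finiteDimensional
  set θ : ℝ := r * (|K| + 1) with hθ
  have hθ0 : 0 < θ := by positivity
  have hq1 : 1 < 1 + θ⁻¹ := by simpa using hθ0
  have htest : ∀ (ξ : E), ξ ≠ 0 → ∀ (s : Finset ℕ) (a : ℝ), (a : ℂ) • ξ ∈ W →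
      (∃ C : ℝ, ∀ k, |a + ∑ j ∈ Finset.range k, if j ∈ s then ‖Φ j ξ‖⁻¹ else 0| * ‖Φ k ξ‖ ≤ C) →
      ∀ k, |a + ∑ j ∈ Finset.range k, if j ∈ s then ‖Φ j ξ‖⁻¹ else 0| ≤ θ * ‖Φ k ξ‖⁻¹ := by
    intro ξ hξ s a haW hC k
    have hpos : ∀ j, 0 < ‖Φ j ξ‖ := fun j => by simpa using hξ
    set c : ℕ → ℝ := fun k => a + ∑ j ∈ Finset.range k, if j ∈ s then ‖Φ j ξ‖⁻¹ else 0 with hc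
    have hnorm : ∀ k, ‖(c k : ℂ) • Φ k ξ‖ = |c k| * ‖Φ k ξ‖ := fun k => by
      rw [norm_smul, Complex.norm_real, Real.norm_eq_abs]
    have := hbound (fun k => (c k : ℂ) • Φ k ξ)
      (fun k => ((if k ∈ s then ‖Φ k ξ‖⁻¹ else 0 : ℝ) : ℂ) • Φ (k + 1) ξ) (|K| + 1)
      (fun k => by
        simp only [map_smul, ContinuousLinearEquiv.symm_apply_apply, hc,
          Finset.sum_range_succ]
        rw [← add_smul]
        push_cast
        ring_nf)
      (fun k => by
        split_ifs
        · rw [norm_smul, Complex.norm_real, Real.norm_of_nonneg (inv_nonneg.2 (norm_nonneg _)),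
            inv_mul_le_iff₀ (hpos k)]
          have h1 := hK k ξ
          have h2 : K * ‖Φ k ξ‖ ≤ (|K| + 1) * ‖Φ k ξ‖ := by
            gcongr
            linarith [le_abs_self K]
          linarith
        · rw [Complex.ofReal_zero, zero_smul, norm_zero]
          positivity)
      (by simpa only [hnorm] using hC)
      (by
        rw [map_smul, ContinuousLinearEquiv.symm_apply_apply]
        simpa [hc] using haW) k
    rw [hnorm] at this
    rwa [← div_eq_mul_inv, le_div_iff₀ (hpos k)]
  have hexp : ∀ {m k : ℕ}, m ≤ k →
      Real.exp (-Real.log (1 + θ⁻¹) * (k - m : ℝ)) = ((1 + θ⁻¹) ^ (k - m))⁻¹ := by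
    intro m k hmk
    rw [neg_mul, Real.exp_neg, ← Nat.cast_sub hmk, mul_comm, Real.exp_nat_mul,
      Real.exp_log (by linarith)]
  refine ⟨boundedInitialValues Φ, W, hW, θ + 1, by positivity, Real.log (1 + θ⁻¹),
    Real.log_pos hq1, fun m k hmk => ⟨fun ξ hξU => ?_, fun ξ hξW => ?_⟩⟩
  · rcases eq_or_ne ξ 0 with rfl | hξ
    · simp
    have hpos : ∀ j, 0 < ‖Φ j ξ‖ := fun j => by simpa using hξ
    have hsum : ∀ k, m < k → ∑ j ∈ Finset.Ico m k, ‖Φ j ξ‖⁻¹ ≤ θ * ‖Φ k ξ‖⁻¹ := by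
      intro k hmk
      obtain ⟨C, hC⟩ := hξU
      have h1 := htest ξ hξ (Finset.Ico m k) 0 (by simp)
        ⟨(∑ j ∈ Finset.Ico m k, ‖Φ j ξ‖⁻¹) * C, fun l => by
          rw [zero_add, ← Finset.sum_filter, abs_of_nonneg (Finset.sum_nonneg fun j _ =>
            inv_nonneg.2 (norm_nonneg _))]
          refine mul_le_mul ?_ (hC l) (norm_nonneg _)
            (Finset.sum_nonneg fun j _ => inv_nonneg.2 (norm_nonneg _))
          refine Finset.sum_le_sum_of_subset_of_nonneg ?_ fun j _ _ => inv_nonneg.2 (norm_nonneg _)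
          intro j hj
          exact (Finset.mem_filter.1 hj).2⟩ k
      rw [zero_add, ← Finset.sum_filter] at h1
      have h2 : (Finset.range k).filter (· ∈ Finset.Ico m k) = Finset.Ico m k := by
        ext j; simp only [Finset.mem_filter, Finset.mem_range, Finset.mem_Ico]; omega
      rw [h2] at h1
      exact (le_abs_self _).trans h1
    have h1 := pow_mul_le_of_sum_Ico_le_right hθ0 hsum (fun j => inv_nonneg.2 (norm_nonneg _)) hmk
    rw [hexp hmk]
    have h2 : 0 < (1 + θ⁻¹) ^ (k - m) := by positivity
    rw [← div_eq_mul_inv, ← div_eq_mul_inv, div_le_div_iff₀ (hpos m) (hpos k)] at h1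
    rw [mul_assoc, mul_left_comm, inv_mul_eq_div, le_div_iff₀ h2]
    linarith
  · rcases eq_or_ne ξ 0 with rfl | hξ
    · simp
    have hpos : ∀ j, 0 < ‖Φ j ξ‖ := fun j => by simpa using hξ
    have hsum : ∀ l, m ≤ l → l ≤ k → ∑ j ∈ Finset.Ico l (k + 1), ‖Φ j ξ‖⁻¹ ≤ θ * ‖Φ l ξ‖⁻¹ := by
      intro l _ hlk
      set a := ∑ j ∈ Finset.Ico l (k + 1), ‖Φ j ξ‖⁻¹ with ha
      have hlarge : ∀ i, k + 1 ≤ i →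
          (Finset.range i).filter (· ∈ Finset.Ico l (k + 1)) = Finset.Ico l (k + 1) := by
        intro i hi
        ext j; simp only [Finset.mem_filter, Finset.mem_range, Finset.mem_Ico]; omega
      have h1 := htest ξ hξ (Finset.Ico l (k + 1)) (-a) (W.smul_mem _ hξW)
        ⟨∑ i ∈ Finset.range (k + 1), |-a + ∑ j ∈ Finset.range i,
            if j ∈ Finset.Ico l (k + 1) then ‖Φ j ξ‖⁻¹ else 0| * ‖Φ i ξ‖, fun i => by
          by_cases hi : i < k + 1
          · exact Finset.single_le_sum (f := fun i => |-a + ∑ j ∈ Finset.range i,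
              if j ∈ Finset.Ico l (k + 1) then ‖Φ j ξ‖⁻¹ else 0| * ‖Φ i ξ‖)
              (fun _ _ => by positivity) (Finset.mem_range.2 hi)
          · rw [← Finset.sum_filter, hlarge i (not_lt.1 hi), ← ha, neg_add_cancel, abs_zero,
              zero_mul]
            exact Finset.sum_nonneg fun _ _ => by positivity⟩ l
      have h2 : (Finset.range l).filter (· ∈ Finset.Ico l (k + 1)) = ∅ := by
        ext j; simp only [Finset.mem_filter, Finset.mem_range, Finset.mem_Ico, Finset.notMem_empty,
          iff_false]; omega
      rw [← Finset.sum_filter, h2, Finset.sum_empty, add_zero, abs_neg] at h1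
      exact (le_abs_self _).trans h1
    have h1 := pow_mul_le_of_sum_Ico_le_left hθ0 hsum (fun j => inv_nonneg.2 (norm_nonneg _)) hmk
    rw [hexp hmk]
    have h2 : 0 < (1 + θ⁻¹) ^ (k - m) := by positivity
    rw [← div_eq_mul_inv, ← div_eq_mul_inv, div_le_div_iff₀ (hpos k) (hpos m)] at h1
    rw [mul_assoc, mul_left_comm, inv_mul_eq_div, le_div_iff₀ h2]
    nlinarith [hpos k]

end DifferenceEquation

/-! ### Geometry of a time scale and the change of time -/

namespace TimeScale

variable {T : Set ℝ}

theorem sigma_set_nonempty (hT : IsTimeScale T) (t : ℝ) : {u | u ∈ T ∧ t < u}.Nonempty := by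
  obtain ⟨u, hu, htu⟩ := not_bddAbove_iff.1 hT.unbounded t
  exact ⟨u, hu, htu⟩

theorem sigma_set_bddBelow (t : ℝ) : BddBelow {u | u ∈ T ∧ t < u} := ⟨t, fun _ hu => hu.2.le⟩

theorem le_sigma (hT : IsTimeScale T) (t : ℝ) : t ≤ sigma T t :=
  le_csInf (sigma_set_nonempty hT t) fun _ hu => hu.2.le

theorem mu_nonneg (hT : IsTimeScale T) (t : ℝ) : 0 ≤ mu T t := sub_nonneg.2 (le_sigma hT t)

theorem sigma_mem (hT : IsTimeScale T) (t : ℝ) : sigma T t ∈ T := by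
  have h := csInf_mem_closure (sigma_set_nonempty hT t) (sigma_set_bddBelow t)
  exact hT.isClosed.closure_subset_iff.2 (fun _ hu => hu.1) h

theorem sigma_le {t u : ℝ} (hu : u ∈ T) (htu : t < u) : sigma T t ≤ u :=
  csInf_le (sigma_set_bddBelow t) ⟨hu, htu⟩

theorem sigma_mono (hT : IsTimeScale T) : Monotone (sigma T) := fun _ t hst =>
  csInf_le_csInf (sigma_set_bddBelow _) (sigma_set_nonempty hT t)
    fun _ hu => ⟨hu.1, hst.trans_lt hu.2⟩

theorem floor_set_bddAbove (t : ℝ) : BddAbove {τ | τ ∈ T ∧ τ ≤ t} := ⟨t, fun _ hu => hu.2⟩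

theorem floor_mem_le (hT : IsTimeScale T) {t : ℝ} (ht : 0 ≤ t) :
    floor T t ∈ T ∧ floor T t ≤ t := by
  have hc : IsClosed {τ | τ ∈ T ∧ τ ≤ t} := hT.isClosed.inter isClosed_Iic
  exact hc.csSup_mem ⟨0, hT.zero_mem, ht⟩ (floor_set_bddAbove t)

theorem le_floor {a t : ℝ} (ha : a ∈ T) (hat : a ≤ t) : a ≤ floor T t :=
  le_csSup (floor_set_bddAbove t) ⟨ha, hat⟩

theorem floor_of_mem (hT : IsTimeScale T) {t : ℝ} (ht : t ∈ T) : floor T t = t :=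
  le_antisymm (floor_mem_le hT (hT.subset_nonneg ht)).2 (le_floor ht le_rfl)

theorem floor_of_neg (hT : IsTimeScale T) {t : ℝ} (ht : t < 0) : floor T t = 0 := by
  have : {τ | τ ∈ T ∧ τ ≤ t} = ∅ := by
    ext τ
    simp only [mem_ofPred_eq, mem_empty_iff_false, iff_false, not_and, not_le]
    exact fun hτ => ht.trans_le (hT.subset_nonneg hτ)
  rw [floor, this, Real.sSup_empty]

theorem floor_mem (hT : IsTimeScale T) (t : ℝ) : floor T t ∈ T := by
  rcases le_or_gt 0 t with ht | ht
  · exact (floor_mem_le hT ht).1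
  · rw [floor_of_neg hT ht]; exact hT.zero_mem

theorem floor_mono (hT : IsTimeScale T) : Monotone (floor T) := by
  intro a b hab
  rcases le_or_gt 0 a with ha | ha
  · exact le_floor (floor_mem_le hT ha).1 ((floor_mem_le hT ha).2.trans hab)
  · rw [floor_of_neg hT ha]; exact hT.subset_nonneg (floor_mem hT b)

theorem floor_eq_of_mem_Ico (hT : IsTimeScale T) {a t : ℝ} (ha : a ∈ T)
    (ht : t ∈ Ico a (sigma T a)) : floor T t = a := by
  obtain ⟨h1, h2⟩ := floor_mem_le hT ((hT.subset_nonneg ha).trans ht.1)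
  refine le_antisymm ?_ (le_floor ha ht.1)
  by_contra! h
  exact absurd (sigma_le h1 h) (not_le.2 (h2.trans_lt ht.2))

theorem notMem_of_mem_Ioo {a t : ℝ} (ht : t ∈ Ioo a (sigma T a)) : t ∉ T := fun h =>
  absurd (sigma_le h ht.1) (not_le.2 ht.2)

/-- A point off the time scale lies in the gap that starts at its floor. -/
theorem mem_Ioo_floor (hT : IsTimeScale T) {t : ℝ} (ht : 0 ≤ t) (htT : t ∉ T) :
    t ∈ Ioo (floor T t) (sigma T (floor T t)) := by
  obtain ⟨h1, h2⟩ := floor_mem_le hT ht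
  refine ⟨lt_of_le_of_ne h2 fun h => htT (h ▸ h1), ?_⟩
  refine lt_of_le_of_ne (le_csInf (sigma_set_nonempty hT _) fun u hu => ?_)
    fun h => htT (h ▸ sigma_mem hT _)
  by_contra! h
  exact absurd (le_floor hu.1 h.le) (not_le.2 hu.2)

theorem mu_floor_pos (hT : IsTimeScale T) {t : ℝ} (ht : 0 ≤ t) (htT : t ∉ T) :
    0 < mu T (floor T t) := by
  have := mem_Ioo_floor hT ht htT
  exact sub_pos.2 (this.1.trans this.2)

theorem rate_pos {m : ℝ} (hm : 0 ≤ m) : 0 < rate m := by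
  unfold rate
  split_ifs with h
  · exact one_pos
  · have : 0 < m := lt_of_le_of_ne hm (Ne.symm h)
    exact div_pos (Real.log_pos (by linarith)) this

theorem rate_le_one {m : ℝ} (hm : 0 ≤ m) : rate m ≤ 1 := by
  unfold rate
  split_ifs with h
  · exact le_rfl
  · have h1 : 0 < m := lt_of_le_of_ne hm (Ne.symm h)
    rw [div_le_one h1]
    have := Real.log_le_sub_one_of_pos (show 0 < 1 + m by linarith)
    linarith

theorem inv_le_rate {m M : ℝ} (hm : 0 ≤ m) (hM : m ≤ M) : (1 + M)⁻¹ ≤ rate m := by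
  have h0 : (1 + M)⁻¹ ≤ (1 + m)⁻¹ := inv_anti₀ (by linarith) (by linarith)
  refine h0.trans ?_
  unfold rate
  split_ifs with h
  · exact inv_le_one_of_one_le₀ (by linarith)
  · have h1 : 0 < m := lt_of_le_of_ne hm (Ne.symm h)
    rw [le_div_iff₀ h1]
    have := Real.one_sub_inv_le_log_of_pos (show 0 < 1 + m by linarith)
    have h2 : (1 + m)⁻¹ * m = 1 - (1 + m)⁻¹ := by field_simp; ring
    linarith

theorem rate_mul_self (m : ℝ) : rate m * m = Real.log (1 + m) := by
  unfold rate
  split_ifs with h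
  · simp [h]
  · field_simp

theorem measurable_rate : Measurable rate := by
  unfold rate
  exact Measurable.ite (measurableSet_singleton 0) measurable_const (by fun_prop)

theorem tendsto_rate_zero : Tendsto rate (𝓝 0) (𝓝 1) := by
  have hd : HasDerivAt (fun m : ℝ => Real.log (1 + m)) 1 0 := by
    simpa using ((hasDerivAt_id (0 : ℝ)).const_add 1).log (by simp)
  have h1 : Tendsto rate (𝓝[≠] 0) (𝓝 1) := by
    refine (hasDerivAt_iff_tendsto_slope.1 hd).congr' ?_
    filter_upwards [self_mem_nhdsWithin] with m hm
    have hm' : m ≠ 0 := hm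
    simp [slope_def_field, rate, hm']
  have h2 : ContinuousAt rate 0 := by
    rw [continuousAt_iff_punctured_nhds]
    simpa [rate] using h1
  simpa [ContinuousAt, rate] using h2

theorem measurable_rate_mu_floor (hT : IsTimeScale T) :
    Measurable fun τ => rate (mu T (floor T τ)) :=
  measurable_rate.comp (((sigma_mono hT).measurable.sub measurable_id).comp
    (floor_mono hT).measurable)

theorem intervalIntegrable_rate (hT : IsTimeScale T) (a b : ℝ) :
    IntervalIntegrable (fun τ => rate (mu T (floor T τ))) volume a b := by
  refine (intervalIntegrable_const (c := (1 : ℝ))).mono_fun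
    (measurable_rate_mu_floor hT).aestronglyMeasurable (Eventually.of_forall fun τ => ?_)
  simp only [norm_one]
  rw [Real.norm_of_nonneg (rate_pos (mu_nonneg hT _)).le]
  exact rate_le_one (mu_nonneg hT _)

theorem newTime_sub (hT : IsTimeScale T) (a b : ℝ) :
    newTime T b - newTime T a = ∫ τ in a..b, rate (mu T (floor T τ)) :=
  intervalIntegral.integral_interval_sub_left (intervalIntegrable_rate hT _ _)
    (intervalIntegrable_rate hT _ _)

theorem newTime_zero : newTime T 0 = 0 := by simp [newTime]

theorem newTime_sub_le (hT : IsTimeScale T) {a b : ℝ} (hab : a ≤ b) :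
    newTime T b - newTime T a ≤ b - a := by
  rw [newTime_sub hT]
  have := intervalIntegral.integral_mono_on hab (intervalIntegrable_rate hT a b)
    (intervalIntegrable_const (c := (1 : ℝ))) fun τ _ => rate_le_one (mu_nonneg hT _)
  simpa using this

theorem le_newTime_sub (hT : IsTimeScale T) {M : ℝ} (hM : ∀ t ∈ T, mu T t ≤ M) {a b : ℝ}
    (hab : a ≤ b) : (1 + M)⁻¹ * (b - a) ≤ newTime T b - newTime T a := by
  rw [newTime_sub hT]
  have := intervalIntegral.integral_mono_on hab (intervalIntegrable_const (c := (1 + M)⁻¹))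
    (intervalIntegrable_rate hT a b) fun τ _ => inv_le_rate (mu_nonneg hT _)
      (hM _ (floor_mem hT τ))
  rw [intervalIntegral.integral_const, smul_eq_mul, mul_comm] at this
  exact this

theorem exists_mu_bound (hT : IsTimeScale T) (hs : IsSyndetic T) :
    ∃ M : ℝ, 0 ≤ M ∧ ∀ t ∈ T, mu T t ≤ M := by
  obtain ⟨M, hM⟩ := hs
  have h : ∀ t ∈ T, mu T t ≤ M := fun t ht => hM ⟨t, ht, rfl⟩
  exact ⟨M, (mu_nonneg hT 0).trans (h 0 hT.zero_mem), h⟩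

theorem strictMono_newTime (hT : IsTimeScale T) (hs : IsSyndetic T) : StrictMono (newTime T) := by
  obtain ⟨M, hM0, hM⟩ := exists_mu_bound hT hs
  intro a b hab
  have h1 := le_newTime_sub hT hM hab.le
  have h2 : 0 < (1 + M)⁻¹ * (b - a) := mul_pos (by positivity) (sub_pos.2 hab)
  linarith

theorem continuous_newTime (hT : IsTimeScale T) : Continuous (newTime T) :=
  intervalIntegral.continuous_primitive (intervalIntegrable_rate hT) 0

theorem surjective_newTime (hT : IsTimeScale T) (hs : IsSyndetic T) :
    Function.Surjective (newTime T) := by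
  obtain ⟨M, hM0, hM⟩ := exists_mu_bound hT hs
  have hc : 0 < (1 + M)⁻¹ := by positivity
  refine (continuous_newTime hT).surjective ?_ ?_
  · refine tendsto_atTop_mono' atTop ?_ (tendsto_id.const_mul_atTop hc)
    filter_upwards [eventually_ge_atTop 0] with t ht
    have := le_newTime_sub hT hM ht
    rw [newTime_zero, sub_zero, sub_zero] at this
    exact this
  · refine tendsto_atBot_mono' atBot ?_ (tendsto_id.const_mul_atBot hc)
    filter_upwards [eventually_le_atBot 0] with t ht
    have := le_newTime_sub hT hM ht
    rw [newTime_zero] at this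
    simp only [id]
    linarith

/-- The change of time as an order isomorphism of `ℝ`. (On `(-∞, 0)` the floor takes the value `0`,
so the defining integral is strictly increasing there as well.) -/
noncomputable def timeIso (hT : IsTimeScale T) (hs : IsSyndetic T) : ℝ ≃o ℝ :=
  StrictMono.orderIsoOfSurjective (newTime T) (strictMono_newTime hT hs) (surjective_newTime hT hs)

theorem timeIso_apply (hT : IsTimeScale T) (hs : IsSyndetic T) (t : ℝ) :
    timeIso hT hs t = newTime T t := rfl

theorem newTime_nonneg (hT : IsTimeScale T) (hs : IsSyndetic T) {t : ℝ} (ht : 0 ≤ t) :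
    0 ≤ newTime T t := by
  rw [← newTime_zero (T := T)]; exact (strictMono_newTime hT hs).monotone ht

theorem timeIso_symm_nonneg (hT : IsTimeScale T) (hs : IsSyndetic T) {u : ℝ} (hu : 0 ≤ u) :
    0 ≤ (timeIso hT hs).symm u := by
  rw [(timeIso hT hs).le_symm_apply, timeIso_apply, newTime_zero]; exact hu

theorem invFunOn_newTime (hT : IsTimeScale T) (hs : IsSyndetic T) {u : ℝ} (hu : 0 ≤ u) :
    Function.invFunOn (newTime T) (Ici 0) u = (timeIso hT hs).symm u := by
  have hex : ∃ a ∈ Ici (0 : ℝ), newTime T a = u :=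
    ⟨_, timeIso_symm_nonneg hT hs hu, (timeIso hT hs).apply_symm_apply u⟩
  apply (timeIso hT hs).injective
  rw [OrderIso.apply_symm_apply, timeIso_apply]
  exact Function.invFunOn_eq hex

theorem newTime_sub_of_mem_Icc (hT : IsTimeScale T) {a t : ℝ} (ha : a ∈ T)
    (ht : t ∈ Icc a (sigma T a)) : newTime T t - newTime T a = rate (mu T a) * (t - a) := by
  rw [newTime_sub hT, intervalIntegral.integral_congr_ae (g := fun _ => rate (mu T a))]
  · rw [intervalIntegral.integral_const, smul_eq_mul, mul_comm]
  · have : ∀ᵐ s : ℝ, s ≠ t := Measure.ae_ne volume t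
    filter_upwards [this] with s hs hs'
    rw [uIoc_of_le ht.1] at hs'
    rw [floor_eq_of_mem_Ico hT ha ⟨hs'.1.le, (lt_of_le_of_ne hs'.2 hs).trans_le ht.2⟩]

theorem newTime_sigma_sub (hT : IsTimeScale T) {a : ℝ} (ha : a ∈ T) :
    newTime T (sigma T a) - newTime T a = Real.log (1 + mu T a) := by
  rw [newTime_sub_of_mem_Icc hT ha ⟨le_sigma hT a, le_rfl⟩]
  exact rate_mul_self (mu T a)

/-- A property of the points of `T` near `t` holds for the floors of all points between `t` and
a point of `T` near `t`. -/
theorem eventually_forall_uIcc_floor (hT : IsTimeScale T) {t : ℝ} (ht : t ∈ T) {p : ℝ → Prop}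
    (hp : ∀ᶠ a in 𝓝[T] t, p a) : ∀ᶠ t' in 𝓝[T] t, ∀ τ ∈ uIcc t t', p (floor T τ) := by
  obtain ⟨δ, hδ, hδp⟩ := Metric.mem_nhdsWithin_iff.1 hp
  filter_upwards [self_mem_nhdsWithin, mem_nhdsWithin_of_mem_nhds (Metric.ball_mem_nhds t hδ)]
    with t' ht' htb τ hτ
  refine hδp ⟨?_, floor_mem hT τ⟩
  rw [Metric.mem_ball, Real.dist_eq, abs_lt] at htb ⊢
  have hm : min t t' ≤ floor T τ := by
    refine le_floor ?_ hτ.1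
    rcases min_choice t t' with h | h <;> rw [h] <;> assumption
  have hM : floor T τ ≤ max t t' := by
    refine (floor_mem_le hT ?_).2.trans hτ.2
    refine le_trans ?_ hτ.1
    exact le_min (hT.subset_nonneg ht) (hT.subset_nonneg ht')
  rcases le_total t t' with h | h
  · rw [min_eq_left h] at hm; rw [max_eq_right h] at hM
    constructor <;> linarith
  · rw [min_eq_right h] at hm; rw [max_eq_left h] at hM
    constructor <;> linarith

theorem tendsto_mu_of_tendsto_sigma {l : Filter ℝ} {t : ℝ} (hl : Tendsto id l (𝓝 t))
    (hs : Tendsto (sigma T) l (𝓝 t)) : Tendsto (mu T) l (𝓝 0) := by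
  have := hs.sub hl
  rw [sub_self] at this
  exact this

theorem tendsto_sigma_of_rightDense (hT : IsTimeScale T) {t : ℝ}
    (hd : mu T t = 0) : Tendsto (sigma T) (𝓝[T] t) (𝓝 t) := by
  have hst : sigma T t = t := sub_eq_zero.1 hd
  rw [Metric.tendsto_nhds]
  intro ε hε
  obtain ⟨u, ⟨huT, htu⟩, hu⟩ : ∃ u ∈ {u | u ∈ T ∧ t < u}, u < t + ε :=
    exists_lt_of_csInf_lt (sigma_set_nonempty hT t) (by
      change sigma T t < t + ε
      rw [hst]; linarith)
  filter_upwards [mem_nhdsWithin_of_mem_nhds (Ioo_mem_nhds (show t - ε < t by linarith) htu)]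
    with a ha
  rw [Real.dist_eq, abs_lt]
  have h1 := sigma_le huT ha.2
  have h2 := le_sigma hT a
  constructor <;> linarith [ha.1]

theorem tendsto_mu_of_rightDense (hT : IsTimeScale T) {t : ℝ}
    (hd : mu T t = 0) : Tendsto (mu T) (𝓝[T] t) (𝓝 0) :=
  tendsto_mu_of_tendsto_sigma (tendsto_id.mono_left nhdsWithin_le_nhds)
    (tendsto_sigma_of_rightDense hT hd)

theorem tendsto_sigma_of_leftDense (hT : IsTimeScale T) {t : ℝ} (ht : t ∈ T) :
    Tendsto (sigma T) (𝓝[T ∩ Iio t] t) (𝓝 t) := by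
  refine tendsto_of_tendsto_of_tendsto_of_le_of_le'
    (tendsto_id.mono_left nhdsWithin_le_nhds) tendsto_const_nhds
    (Eventually.of_forall fun a => le_sigma hT a) ?_
  filter_upwards [self_mem_nhdsWithin] with a ha using sigma_le ht ha.2

/-- Differentiation of an integral along a set `S`, when the integrand is close to `γ` on the
whole segment between `t` and each nearby point of `S`. -/
theorem hasDerivWithinAt_of_integral {E : Type*} [NormedAddCommGroup E] [NormedSpace ℝ E]
    [CompleteSpace E] {F g : ℝ → E} {γ : E} {S : Set ℝ} {t : ℝ}
    (hF : ∀ t' ∈ S, F t' - F t = ∫ τ in t..t', g τ)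
    (hg : ∀ t' ∈ S, IntervalIntegrable g volume t t')
    (h : ∀ ε > 0, ∀ᶠ t' in 𝓝[S] t, ∀ τ ∈ uIcc t t', ‖g τ - γ‖ ≤ ε) :
    HasDerivWithinAt F γ S t := by
  rw [hasDerivWithinAt_iff_isLittleO, Asymptotics.isLittleO_iff]
  intro ε hε
  filter_upwards [h ε hε, self_mem_nhdsWithin] with t' ht' htS
  have hc : ∫ _ in t..t', γ = (t' - t) • γ := intervalIntegral.integral_const γ
  rw [hF t' htS, ← hc, ← intervalIntegral.integral_sub (hg t' htS) intervalIntegrable_const]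
  exact intervalIntegral.norm_integral_le_of_norm_le_const fun τ hτ => ht' τ (uIoc_subset_uIcc hτ)

theorem hasDerivWithinAt_newTime (hT : IsTimeScale T) {t : ℝ} (ht : t ∈ T) (hd : mu T t = 0) :
    HasDerivWithinAt (newTime T) 1 T t := by
  refine hasDerivWithinAt_of_integral (fun t' _ => newTime_sub hT t t')
    (fun t' _ => intervalIntegrable_rate hT t t') fun ε hε => ?_
  refine eventually_forall_uIcc_floor hT ht (p := fun a => ‖rate (mu T a) - 1‖ ≤ ε) ?_
  have := (tendsto_rate_zero.comp (tendsto_mu_of_rightDense hT hd))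
  filter_upwards [Metric.tendsto_nhds.1 this ε hε] with a ha
  rw [dist_eq_norm] at ha
  exact ha.le

end TimeScale

/-! ### The coefficient of the associated differential equation -/

/-- Entrywise complexification of real square matrices. -/
noncomputable def complexify (n : ℕ) : Matrix (Fin n) (Fin n) ℝ →ₐ[ℝ] Matrix (Fin n) (Fin n) ℂ :=
  Complex.ofRealAm.mapMatrix

theorem complexify_apply {n : ℕ} (X : Matrix (Fin n) (Fin n) ℝ) :
    complexify n X = X.map Complex.ofReal := rfl

theorem continuous_complexify (n : ℕ) : Continuous (complexify n) :=
  (complexify n).toLinearMap.continuous_of_finiteDimensional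

theorem exists_norm_complexify_le (n : ℕ) :
    ∃ c : ℝ, 0 ≤ c ∧ ∀ X : Matrix (Fin n) (Fin n) ℝ, ‖complexify n X‖ ≤ c * ‖X‖ := by
  let f := LinearMap.toContinuousLinearMap (complexify n).toLinearMap
  exact ⟨‖f‖, norm_nonneg f, f.le_opNorm⟩

/-- A property that holds near `x` holds on the whole segment between `x` and any nearby point. -/
theorem eventually_forall_uIcc {x : ℝ} {p : ℝ → Prop} (hp : ∀ᶠ y in 𝓝 x, p y) :
    ∀ᶠ y in 𝓝 x, ∀ z ∈ uIcc x y, p z := by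
  obtain ⟨δ, hδ, hδp⟩ := Metric.eventually_nhds_iff_ball.1 hp
  filter_upwards [Metric.ball_mem_nhds x hδ] with y hy z hz
  exact hδp z ((convex_ball x δ).ordConnected.uIcc_subset (Metric.mem_ball_self hδ) hy hz)

namespace TimeScale

variable {n : ℕ} {T : Set ℝ} {A : ℝ → Matrix (Fin n) (Fin n) ℝ}
  {L : Matrix (Fin n) (Fin n) ℂ → Matrix (Fin n) (Fin n) ℂ}

theorem odeCoeff_newTime_of_mem (hT : IsTimeScale T) (hs : IsSyndetic T) {t : ℝ} (ht : t ∈ T) :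
    odeCoeff L T A (newTime T t) = complexify n (A t) := by
  have h := invFunOn_newTime hT hs (newTime_nonneg hT hs (hT.subset_nonneg ht))
  rw [← timeIso_apply hT hs, OrderIso.symm_apply_apply, timeIso_apply] at h
  simp only [odeCoeff, h, ht, if_true, complexify_apply]

theorem odeCoeff_newTime_of_notMem (hT : IsTimeScale T) (hs : IsSyndetic T) {t : ℝ} (ht0 : 0 ≤ t)
    (ht : t ∉ T) : odeCoeff L T A (newTime T t) = (Real.log (1 + mu T (floor T t)))⁻¹ •
      L (1 + mu T (floor T t) • complexify n (A (floor T t))) := by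
  have h := invFunOn_newTime hT hs (newTime_nonneg hT hs ht0)
  rw [← timeIso_apply hT hs, OrderIso.symm_apply_apply, timeIso_apply] at h
  simp only [odeCoeff, h, ht, if_false, ← complexify_apply, map_add, map_one, map_smul]

theorem exists_norm_complexify_coeff_le (hA : BoundedOn T A) :
    ∃ R : ℝ, 0 ≤ R ∧ ∀ t ∈ T, ‖complexify n (A t)‖ ≤ R := by
  obtain ⟨c, hc, hcX⟩ := exists_norm_complexify_le n
  obtain ⟨C, hC⟩ := hA
  refine ⟨c * |C|, by positivity, fun t ht => (hcX _).trans ?_⟩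
  exact mul_le_mul_of_nonneg_left ((hC t ht).trans (le_abs_self C)) hc

theorem isUnit_one_add_mu (hreg : UniformlyRegressive T A) {t : ℝ} (ht : t ∈ T) :
    IsUnit (1 + mu T t • complexify n (A t)) := by
  have := (hreg.1 t ht).map (complexify n)
  rwa [map_add, map_one, map_smul] at this

theorem exists_norm_inv_le (hreg : UniformlyRegressive T A) :
    ∃ R : ℝ, ∀ t ∈ T, ‖(1 + mu T t • complexify n (A t))⁻¹‖ ≤ R := by
  obtain ⟨c, hc, hcX⟩ := exists_norm_complexify_le n
  obtain ⟨C, hC⟩ := hreg.2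
  refine ⟨c * |C|, fun t ht => ?_⟩
  have h1 : (1 + mu T t • complexify n (A t))⁻¹ = complexify n ((1 + mu T t • A t)⁻¹) := by
    refine Matrix.inv_eq_right_inv ?_
    have h2 := Matrix.mul_nonsing_inv (1 + mu T t • A t)
      ((Matrix.isUnit_iff_isUnit_det _).1 (hreg.1 t ht))
    have := congrArg (complexify n) h2
    rwa [map_mul, map_one, map_add, map_one, map_smul] at this
  rw [h1]
  exact (hcX _).trans (mul_le_mul_of_nonneg_left ((hC t ht).trans (le_abs_self C)) hc)

/-- The coefficient is bounded: on short gaps it is close to `A`, because a matrix logarithm is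
asymptotic to `M - 1` at `M = 1`; on long gaps uniform regressivity bounds the logarithm. -/
theorem exists_norm_odeCoeff_le (hT : IsTimeScale T) (hs : IsSyndetic T) (hA : BoundedOn T A)
    (hreg : UniformlyRegressive T A) (hL : IsMatrixLog n L) :
    ∃ K : ℝ, ∀ u, 0 ≤ u → ‖odeCoeff L T A u‖ ≤ K := by
  obtain ⟨R, hR0, hR⟩ := exists_norm_complexify_coeff_le hA
  obtain ⟨R', hR'⟩ := exists_norm_inv_le hreg
  obtain ⟨M, hM0, hM⟩ := exists_mu_bound hT hs
  obtain ⟨δ, hδ, hδL⟩ := hL.norm_log_smul_sub_le R one_pos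
  set R₂ : ℝ := max (‖(1 : Matrix (Fin n) (Fin n) ℂ)‖ + M * R) R' with hR₂
  obtain ⟨K, hK⟩ := hL.bounded R₂
  refine ⟨max (R + 1) ((Real.log (1 + δ))⁻¹ * |K|), fun u hu => ?_⟩
  obtain ⟨t, rfl⟩ := surjective_newTime hT hs u
  have ht0 : 0 ≤ t := by
    rw [← newTime_zero (T := T)] at hu
    exact (strictMono_newTime hT hs).le_iff_le.1 hu
  by_cases htT : t ∈ T
  · rw [odeCoeff_newTime_of_mem hT hs htT]
    exact ((hR t htT).trans (by linarith)).trans (le_max_left _ _)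
  rw [odeCoeff_newTime_of_notMem hT hs ht0 htT]
  have ha := floor_mem hT t
  have hm := mu_floor_pos hT ht0 htT
  set a := floor T t
  rcases lt_or_ge (mu T a) δ with hmδ | hmδ
  · refine le_trans ?_ (le_max_left _ _)
    have h1 := hδL (mu T a) hm hmδ _ (hR a ha)
    have h2 := norm_le_norm_add_norm_sub (complexify n (A a))
      ((Real.log (1 + mu T a))⁻¹ • L (1 + mu T a • complexify n (A a)))
    rw [norm_sub_rev] at h1
    linarith [hR a ha]
  · refine le_trans ?_ (le_max_right _ _)
    have hlog : 0 < Real.log (1 + δ) := Real.log_pos (by linarith)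
    have hlog' : Real.log (1 + δ) ≤ Real.log (1 + mu T a) :=
      Real.log_le_log (by linarith) (by linarith)
    rw [norm_smul, Real.norm_of_nonneg (inv_nonneg.2 (hlog.trans_le hlog').le)]
    refine mul_le_mul (inv_anti₀ hlog hlog') ?_ (norm_nonneg _) (inv_nonneg.2 hlog.le)
    refine (hK _ (isUnit_one_add_mu hreg ha) ?_ ?_).trans (le_abs_self K)
    · refine le_trans ((norm_add_le _ _).trans ?_) (le_max_left _ _)
      rw [norm_smul, Real.norm_of_nonneg hm.le]
      gcongr
      exacts [hM a ha, hR a ha]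
    · exact (hR' a ha).trans (le_max_right _ _)

/-- At a right-dense point the coefficient is continuous along the segments that end in `T`. -/
theorem eventually_odeCoeff_near (hT : IsTimeScale T) (hs : IsSyndetic T) (hA : BoundedOn T A)
    (hAc : RdContinuous T A) (hL : IsMatrixLog n L) {t : ℝ} (ht : t ∈ T) (hd : mu T t = 0)
    {ε : ℝ} (hε : 0 < ε) :
    ∀ᶠ t' in 𝓝[T] t, ∀ τ ∈ uIcc t t',
      ‖odeCoeff L T A (newTime T τ) - complexify n (A t)‖ ≤ ε := by
  obtain ⟨R, hR0, hR⟩ := exists_norm_complexify_coeff_le hA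
  obtain ⟨δ, hδ, hδL⟩ := hL.norm_log_smul_sub_le R (half_pos hε)
  have h1 : ∀ᶠ a in 𝓝[T] t, dist (complexify n (A a)) (complexify n (A t)) < ε / 2 := by
    have hc : Tendsto (fun a => complexify n (A a)) (𝓝[T] t) (𝓝 (complexify n (A t))) :=
      ((continuous_complexify n).tendsto _).comp ((hAc t ht).1 hd)
    exact Metric.tendsto_nhds.1 hc _ (half_pos hε)
  have h2 : ∀ᶠ a in 𝓝[T] t, mu T a < δ :=
    (tendsto_mu_of_rightDense hT hd).eventually (gt_mem_nhds hδ)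
  filter_upwards [eventually_forall_uIcc_floor hT ht h1, eventually_forall_uIcc_floor hT ht h2,
    self_mem_nhdsWithin] with t' h1' h2' ht' τ hτ
  have hτ0 : 0 ≤ τ := (le_min (hT.subset_nonneg ht) (hT.subset_nonneg ht')).trans hτ.1
  have h3 := h1' τ hτ
  have h4 := h2' τ hτ
  by_cases hτT : τ ∈ T
  · rw [floor_of_mem hT hτT] at h3
    rw [odeCoeff_newTime_of_mem hT hs hτT, ← dist_eq_norm]
    linarith
  · rw [odeCoeff_newTime_of_notMem hT hs hτ0 hτT]
    have h5 := hδL _ (mu_floor_pos hT hτ0 hτT) h4 _ (hR _ (floor_mem hT τ))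
    rw [dist_eq_norm] at h3
    have h6 := norm_sub_le_norm_sub_add_norm_sub
      ((Real.log (1 + mu T (floor T τ)))⁻¹ •
        L (1 + mu T (floor T τ) • complexify n (A (floor T τ))))
      (complexify n (A (floor T τ))) (complexify n (A t))
    linarith

theorem countable_rightScattered (hT : IsTimeScale T) : {t | t ∈ T ∧ mu T t ≠ 0}.Countable := by
  refine Set.PairwiseDisjoint.countable_of_Ioo (y := sigma T) ?_ ?_
  · intro a ha b hb hab
    rw [Function.onFun, Set.disjoint_left]
    rintro x ⟨hx1, hx2⟩ ⟨hx3, hx4⟩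
    rcases lt_or_gt_of_ne hab with h | h
    · linarith [sigma_le hb.1 h]
    · linarith [sigma_le ha.1 h]
  · intro a ha
    exact sub_pos.1 (lt_of_le_of_ne (mu_nonneg hT a) (Ne.symm ha.2))

/-- The coefficient is continuous on the set of (new times of) points off `T` and on the set of
right-dense points; only countably many points remain. -/
theorem aestronglyMeasurable_odeCoeff (hT : IsTimeScale T) (hs : IsSyndetic T)
    (hAc : RdContinuous T A) :
    AEStronglyMeasurable (odeCoeff L T A) (volume.restrict (Ici 0)) := by
  set e := timeIso hT hs with he
  have hec : Continuous e.symm := e.symm.continuous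
  have hee : ∀ u, newTime T (e.symm u) = u := fun u => e.apply_symm_apply u
  set S₁ : Set ℝ := {u | 0 ≤ u ∧ e.symm u ∉ T} with hS₁
  set S₂ : Set ℝ := {u | e.symm u ∈ T ∧ mu T (e.symm u) = 0} with hS₂
  set S₃ : Set ℝ := e '' {t | t ∈ T ∧ mu T t ≠ 0} with hS₃
  have hmT : MeasurableSet {u | e.symm u ∈ T} := hT.isClosed.measurableSet.preimage hec.measurable
  have hmu : Measurable fun u => mu T (e.symm u) :=
    ((sigma_mono hT).measurable.sub measurable_id).comp hec.measurable
  have h1 : AEStronglyMeasurable (odeCoeff L T A) (volume.restrict S₁) := by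
    refine ContinuousOn.aestronglyMeasurable (fun u hu => ?_) (measurableSet_Ici.inter hmT.compl)
    have ht0 : 0 ≤ e.symm u := timeIso_symm_nonneg hT hs hu.1
    have hgap := mem_Ioo_floor hT ht0 hu.2
    have hev : ∀ᶠ v in 𝓝 u, e.symm v ∈ Ioo (floor T (e.symm u)) (sigma T (floor T (e.symm u))) :=
      hec.continuousAt.eventually (isOpen_Ioo.mem_nhds hgap)
    refine ContinuousAt.continuousWithinAt
      (continuousAt_const.congr (f := fun _ => odeCoeff L T A u) ?_)
    filter_upwards [hev] with v hv
    have hv0 : 0 ≤ e.symm v := (hT.subset_nonneg (floor_mem hT _)).trans hv.1.le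
    have hvT : e.symm v ∉ T := notMem_of_mem_Ioo hv
    have hfl := floor_eq_of_mem_Ico hT (floor_mem hT (e.symm u)) (Ioo_subset_Ico_self hv)
    rw [← hee u, ← hee v, odeCoeff_newTime_of_notMem hT hs ht0 hu.2,
      odeCoeff_newTime_of_notMem hT hs hv0 hvT, hfl]
  have h2 : AEStronglyMeasurable (odeCoeff L T A) (volume.restrict S₂) := by
    refine ContinuousOn.aestronglyMeasurable (fun u hu => ?_)
      (hmT.inter (hmu (measurableSet_singleton 0)))
    have hAt : ContinuousWithinAt (fun t => complexify n (A t)) T (e.symm u) :=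
      (continuous_complexify n).continuousAt.comp_continuousWithinAt ((hAc _ hu.1).1 hu.2)
    have hcomp : ContinuousWithinAt (fun v => complexify n (A (e.symm v))) S₂ u :=
      ContinuousWithinAt.comp (f := e.symm) (g := fun t => complexify n (A t)) (t := T) hAt
        hec.continuousWithinAt fun v hv => hv.1
    refine hcomp.congr (fun v hv => ?_) ?_
    · rw [← odeCoeff_newTime_of_mem (L := L) hT hs hv.1, hee]
    · rw [← odeCoeff_newTime_of_mem (L := L) hT hs hu.1, hee]
  have h3 : AEStronglyMeasurable (odeCoeff L T A) (volume.restrict S₃) := by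
    have : volume.restrict S₃ = 0 :=
      Measure.restrict_eq_zero.2 (((countable_rightScattered hT).image e).measure_zero volume)
    rw [this]
    exact aestronglyMeasurable_zero_measure _
  refine (aestronglyMeasurable_union_iff.2
    ⟨aestronglyMeasurable_union_iff.2 ⟨h1, h2⟩, h3⟩).mono_set fun u hu => ?_
  by_cases huT : e.symm u ∈ T
  · by_cases hum : mu T (e.symm u) = 0
    · exact Or.inl (Or.inr ⟨huT, hum⟩)
    · exact Or.inr ⟨_, ⟨huT, hum⟩, e.apply_symm_apply u⟩
  · exact Or.inl (Or.inl ⟨hu, huT⟩)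

/-- A fundamental matrix `Φ` of the associated equation, read along `T`, is a fundamental
matrix of `x^Δ = A(t) x`. -/
theorem exists_fundamentalMatrix (hT : IsTimeScale T) (hs : IsSyndetic T) (hA : BoundedOn T A)
    (hAc : RdContinuous T A) (hreg : UniformlyRegressive T A) (hL : IsMatrixLog n L) :
    ∃ (Φ : ℝ → Matrix (Fin n) (Fin n) ℂ) (K : ℝ), Continuous Φ ∧
      IsFundamentalMatrix (odeCoeff L T A) Φ ∧ 0 ≤ K ∧
      (∀ v, 0 ≤ v → IsUnit (Φ v)) ∧
      (∀ (ζ : Matrix (Fin n) (Fin n) ℂ) (u v : ℝ), 0 ≤ u → 0 ≤ v →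
        ‖Φ v * ζ‖ ≤ Real.exp (K * |v - u|) * ‖Φ u * ζ‖) ∧
      (∀ t ∈ T, mu T t = 0 → HasDerivWithinAt (fun t => Φ (newTime T t))
        (complexify n (A t) * Φ (newTime T t)) T t) ∧
      (∀ t ∈ T, Φ (newTime T (sigma T t)) =
        (1 + mu T t • complexify n (A t)) * Φ (newTime T t)) := by
  obtain ⟨K, hK⟩ := exists_norm_odeCoeff_le hT hs hA hreg hL
  set B : ℝ → Matrix (Fin n) (Fin n) ℂ := (Ici 0).indicator (odeCoeff L T A) with hB
  have hK0 : 0 ≤ K := (norm_nonneg _).trans (hK 0 le_rfl)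
  have hBK : ∀ t, ‖B t‖ ≤ K := by
    intro t
    by_cases ht : t ∈ Ici (0 : ℝ)
    · rw [hB, indicator_of_mem ht]; exact hK t ht
    · rw [hB, indicator_of_notMem ht, norm_zero]; exact hK0
  have hBm : AEStronglyMeasurable B volume :=
    (aestronglyMeasurable_indicator_iff measurableSet_Ici).2
      (aestronglyMeasurable_odeCoeff hT hs hAc)
  have hBi : ∀ a b, IntervalIntegrable B volume a b := fun a b =>
    (intervalIntegrable_const (c := K)).mono_fun hBm.restrict (Eventually.of_forall fun t => by
      rw [Real.norm_of_nonneg hK0]; exact hBK t)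
  have hBeq : ∀ u, 0 ≤ u → B u = odeCoeff L T A u := fun u hu => indicator_of_mem hu _
  obtain ⟨Φ, hΦ, hΦe⟩ := exists_continuous_solution hBK hBi
  have hstep : ∀ u v, 0 ≤ u → 0 ≤ v → Φ v - Φ u = ∫ s in u..v, B s * Φ s := fun u v hu hv =>
    solution_sub hΦ hBi hΦe hu hv
  refine ⟨Φ, K, hΦ, ⟨hΦ.continuousOn, fun t ht => ⟨?_, ?_⟩⟩, hK0,
    fun v hv => isUnit_solution hΦ hBK hBi hΦe hv,
    fun ζ u v hu hv => norm_solution_mul_le hΦ hBK hBi hΦe ζ hu hv, ?_, ?_⟩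
  · refine (hBi 0 t).congr fun s hs => ?_
    rw [uIoc_of_le ht] at hs
    exact hBeq s hs.1.le
  · rw [hΦe t ht]
    congr 1
    refine intervalIntegral.integral_congr fun s hs => ?_
    rw [uIcc_of_le ht] at hs
    simp only [hBeq s hs.1]
  · intro t ht hd
    set e := timeIso hT hs with he
    have ht0 := newTime_nonneg hT hs (hT.subset_nonneg ht)
    have hpos : ∀ v ∈ newTime T '' T, 0 ≤ v := by
      rintro _ ⟨a, ha, rfl⟩
      exact newTime_nonneg hT hs (hT.subset_nonneg ha)
    have hnhds : 𝓝[newTime T '' T] (newTime T t) = map (newTime T) (𝓝[T] t) :=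
      (e.toHomeomorph.isEmbedding.map_nhdsWithin_eq T t).symm
    have hΦd : HasDerivWithinAt Φ (complexify n (A t) * Φ (newTime T t)) (newTime T '' T)
        (newTime T t) := by
      refine hasDerivWithinAt_of_integral (fun v hv => hstep _ _ ht0 (hpos v hv))
        (fun v hv => (hBi _ _).mul_continuousOn hΦ.continuousOn) fun ε hε => ?_
      set X := complexify n (A t) with hX
      set Y := Φ (newTime T t) with hY
      have hc : ∀ᶠ v in 𝓝 (newTime T t), dist (Φ v) Y < min 1 (ε / (2 * (‖X‖ + 1))) :=
        Metric.tendsto_nhds.1 hΦ.continuousAt _ (by positivity)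
      have hc' := (continuous_newTime hT).continuousAt.eventually (eventually_forall_uIcc hc)
      rw [hnhds, eventually_map]
      filter_upwards [eventually_odeCoeff_near hT hs hA hAc hL ht hd
        (show 0 < ε / (2 * (‖Y‖ + 1)) by positivity), mem_nhdsWithin_of_mem_nhds hc',
        self_mem_nhdsWithin] with t' h1 h2 ht' v hv
      have h2v := h2 v hv
      obtain ⟨τ, rfl⟩ := e.surjective v
      have hτ : τ ∈ uIcc t t' := by
        have hv' : newTime T τ ∈ uIcc (newTime T t) (newTime T t') := hv
        simpa only [mem_uIcc, (strictMono_newTime hT hs).le_iff_le] using hv'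
      have hτ0 : 0 ≤ τ := (le_min (hT.subset_nonneg ht) (hT.subset_nonneg ht')).trans hτ.1
      have h1v := h1 τ hτ
      rw [timeIso_apply] at h2v ⊢
      rw [hBeq _ (newTime_nonneg hT hs hτ0)]
      set Z := odeCoeff L T A (newTime T τ)
      set V := Φ (newTime T τ)
      rw [dist_eq_norm, lt_min_iff] at h2v
      have hV : ‖V‖ ≤ ‖Y‖ + 1 := by
        have := norm_le_norm_add_norm_sub Y V
        rw [norm_sub_rev] at this
        linarith
      have hsplit : Z * V - X * Y = (Z - X) * V + X * (V - Y) := by noncomm_ring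
      rw [hsplit]
      calc ‖(Z - X) * V + X * (V - Y)‖ ≤ ‖Z - X‖ * ‖V‖ + ‖X‖ * ‖V - Y‖ :=
            (norm_add_le _ _).trans (add_le_add (norm_mul_le _ _) (norm_mul_le _ _))
        _ ≤ ε / (2 * (‖Y‖ + 1)) * (‖Y‖ + 1) + (‖X‖ + 1) * (ε / (2 * (‖X‖ + 1))) := by
            gcongr
            · linarith
            · exact h2v.2.le
        _ = ε := by field_simp; ring
    have := hΦd.scomp t (hasDerivWithinAt_newTime hT ht hd) (mapsTo_image _ _)
    rw [one_smul] at this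
    exact this
  · intro t ht
    rcases (mu_nonneg hT t).eq_or_lt with hm | hm
    · have : sigma T t = t := sub_eq_zero.1 hm.symm
      rw [this, ← hm, zero_smul, add_zero, one_mul]
    have hlt : t < sigma T t := sub_pos.1 hm
    have ht0 := hT.subset_nonneg ht
    have hs0 := newTime_nonneg hT hs ht0
    have hle : newTime T t ≤ newTime T (sigma T t) :=
      (strictMono_newTime hT hs).monotone hlt.le
    have := solution_eq_exp_mul hΦ (B := B) hle
      (X := (Real.log (1 + mu T t))⁻¹ • L (1 + mu T t • complexify n (A t)))
      (fun r hr => hstep _ _ hs0 (hs0.trans hr.1)) (fun v hv => by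
        obtain ⟨τ, rfl⟩ := surjective_newTime hT hs v
        have hτ : τ ∈ Ioo t (sigma T t) :=
          ⟨(strictMono_newTime hT hs).lt_iff_lt.1 hv.1, (strictMono_newTime hT hs).lt_iff_lt.1 hv.2⟩
        rw [hBeq _ (hs0.trans hv.1.le), odeCoeff_newTime_of_notMem hT hs (ht0.trans hτ.1.le)
          (notMem_of_mem_Ioo hτ), floor_eq_of_mem_Ico hT ht (Ioo_subset_Ico_self hτ)])
    rw [this, newTime_sigma_sub hT ht, smul_smul,
      mul_inv_cancel₀ (Real.log_pos (by linarith)).ne', one_smul,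
      hL.exp_log _ (isUnit_one_add_mu hreg ht)]

end TimeScale

/-! ### Bounded solutions along the new time -/

namespace TimeScale

variable {T : Set ℝ} {E : Type*} [NormedAddCommGroup E] [NormedSpace ℝ E]

theorem hasDeltaDeriv_iff_isLittleO {x : ℝ → E} {γ : E} {t : ℝ} :
    HasDeltaDeriv T x γ t ↔
      (fun s => (x (sigma T t) - x s) - (sigma T t - s) • γ) =o[𝓝[T] t]
        fun s => sigma T t - s := by
  rw [Asymptotics.isLittleO_iff]
  rfl

theorem HasDeltaDeriv.apply_sigma {x : ℝ → E} {γ : E} {t : ℝ} (h : HasDeltaDeriv T x γ t)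
    (ht : t ∈ T) : x (sigma T t) = x t + mu T t • γ := by
  have h1 : ∀ ε > 0, ‖(x (sigma T t) - x t) - (sigma T t - t) • γ‖ ≤ ε * |sigma T t - t| :=
    fun ε hε => (h ε hε).self_of_nhdsWithin ht
  have h2 : ‖(x (sigma T t) - x t) - (sigma T t - t) • γ‖ ≤ 0 := by
    refine le_of_forall_pos_le_add fun ε hε => ?_
    refine (h1 (ε / (|sigma T t - t| + 1)) (by positivity)).trans ?_
    rw [zero_add, div_mul_eq_mul_div, div_le_iff₀ (by positivity)]
    nlinarith [abs_nonneg (sigma T t - t)]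
  have h3 := norm_le_zero_iff.1 h2
  rw [sub_eq_zero, sub_eq_iff_eq_add] at h3
  rw [h3, add_comm]
  rfl

theorem HasDeltaDeriv.continuousWithinAt {x : ℝ → E} {γ : E} {t : ℝ} (h : HasDeltaDeriv T x γ t)
    (ht : t ∈ T) : ContinuousWithinAt x T t := by
  have hid : Tendsto (fun s => sigma T t - s) (𝓝[T] t) (𝓝 (sigma T t - t)) :=
    tendsto_const_nhds.sub (tendsto_id.mono_left nhdsWithin_le_nhds)
  have h1 := ((hasDeltaDeriv_iff_isLittleO.1 h).trans_isBigO
    (hid.isBigO_one ℝ)).tendsto_zero_of_tendsto tendsto_const_nhds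
  have h2 := (tendsto_const_nhds (x := x (sigma T t))).sub ((hid.smul_const γ).add h1)
  have h3 : x (sigma T t) - ((sigma T t - t) • γ + 0) = x t := by
    rw [h.apply_sigma ht, mu]; abel
  rw [h3] at h2
  refine h2.congr fun s => ?_
  abel

theorem HasDeltaDeriv.hasDerivWithinAt {x : ℝ → E} {γ : E} {t : ℝ} (h : HasDeltaDeriv T x γ t)
    (hd : mu T t = 0) : HasDerivWithinAt x γ T t := by
  have hst : sigma T t = t := sub_eq_zero.1 hd
  have h1 := hasDeltaDeriv_iff_isLittleO.1 h
  rw [hst] at h1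
  rw [hasDerivWithinAt_iff_isLittleO]
  refine (h1.neg_left.neg_right).congr (fun s => ?_) fun s => ?_
  · rw [← neg_sub s t, neg_smul]; abel
  · ring

theorem HasDeltaDeriv.clm_comp {F : Type*} [NormedAddCommGroup F] [NormedSpace ℝ F] {x : ℝ → E}
    {γ : E} {t : ℝ} (h : HasDeltaDeriv T x γ t) (f : E →L[ℝ] F) :
    HasDeltaDeriv T (fun s => f (x s)) (f γ) t := by
  rw [hasDeltaDeriv_iff_isLittleO] at h ⊢
  refine (f.isBigO_comp _ _).trans_isLittleO h |>.congr_left fun s => ?_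
  simp only [map_sub, map_smul]

theorem HasDeltaDeriv.add {x y : ℝ → E} {γ δ : E} {t : ℝ} (h : HasDeltaDeriv T x γ t)
    (h' : HasDeltaDeriv T y δ t) : HasDeltaDeriv T (fun s => x s + y s) (γ + δ) t := by
  rw [hasDeltaDeriv_iff_isLittleO] at h h' ⊢
  refine (h.add h').congr_left fun s => ?_
  rw [smul_add]; abel

/-- A function on a time scale with zero `Δ`-derivative is constant: prolonged to be constant
on gaps it is continuous and has zero right derivative everywhere. -/
theorem eq_of_deltaDeriv_zero (hT : IsTimeScale T) {w : ℝ → E}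
    (hσ : ∀ t ∈ T, w (sigma T t) = w t)
    (hd : ∀ t ∈ T, mu T t = 0 → HasDerivWithinAt w 0 T t)
    (hc : ∀ t ∈ T, ContinuousWithinAt w T t) {b : ℝ} (hb : b ∈ T) : w b = w 0 := by
  have hright : ∀ τ, 0 ≤ τ → HasDerivWithinAt (fun τ => w (floor T τ)) 0 (Ici τ) τ := by
    intro τ hτ
    rcases lt_or_ge τ (sigma T (floor T τ)) with hlt | hge
    · refine (hasDerivWithinAt_const τ (Ici τ) (w (floor T τ))).congr_of_eventuallyEq ?_ rfl
      filter_upwards [self_mem_nhdsWithin, mem_nhdsWithin_of_mem_nhds (Iio_mem_nhds hlt)]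
        with r hr1 hr2
      rw [floor_eq_of_mem_Ico hT (floor_mem hT τ) ⟨(floor_mem_le hT hτ).2.trans hr1, hr2⟩]
    · have hτT : τ ∈ T := by
        by_contra h
        exact absurd (mem_Ioo_floor hT hτ h).2 (not_lt.2 hge)
      have hfl := floor_of_mem hT hτT
      rw [hfl] at hge
      have hmu : mu T τ = 0 := sub_eq_zero.2 (le_antisymm hge (le_sigma hT τ))
      have h1 := hd τ hτT hmu
      rw [hasDerivWithinAt_iff_isLittleO, Asymptotics.isLittleO_iff] at h1 ⊢
      intro ε hε
      obtain ⟨δ, hδ, hδp⟩ := Metric.mem_nhdsWithin_iff.1 (h1 hε)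
      filter_upwards [self_mem_nhdsWithin, mem_nhdsWithin_of_mem_nhds (Metric.ball_mem_nhds τ hδ)]
        with r hr hrb
      have hr' : τ ≤ r := hr
      have h2 := (floor_mem_le hT (hτ.trans hr')).2
      have h3 := le_floor hτT hr'
      rw [Metric.mem_ball, Real.dist_eq, abs_of_nonneg (by linarith)] at hrb
      have h4 := hδp ⟨by
        rw [Metric.mem_ball, Real.dist_eq, abs_of_nonneg (by linarith)]
        linarith, floor_mem hT r⟩
      simp only [smul_zero, sub_zero, mem_ofPred_eq] at h4 ⊢
      rw [hfl]
      refine h4.trans ?_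
      rw [Real.norm_of_nonneg (by linarith), Real.norm_of_nonneg (by linarith)]
      gcongr
  have hleft : ∀ τ, 0 ≤ τ → ContinuousWithinAt (fun τ => w (floor T τ)) (Ico 0 τ) τ := by
    intro τ hτ
    by_cases hτT : τ ∈ T
    · rw [ContinuousWithinAt, floor_of_mem hT hτT, Metric.tendsto_nhds]
      intro ε hε
      obtain ⟨δ, hδ, hδp⟩ := Metric.mem_nhdsWithin_iff.1
        (Metric.tendsto_nhds.1 (hc τ hτT) ε hε)
      by_cases hex : ∃ a ∈ T, τ - δ < a ∧ a < τ
      · obtain ⟨a, haT, ha1, ha2⟩ := hex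
        filter_upwards [self_mem_nhdsWithin, mem_nhdsWithin_of_mem_nhds (Ioi_mem_nhds ha2)]
          with r hr hra
        have h1 := le_floor haT (le_of_lt hra)
        have h2 := (floor_mem_le hT hr.1).2
        refine hδp ⟨?_, floor_mem hT r⟩
        rw [Metric.mem_ball, Real.dist_eq, abs_lt]
        constructor <;> linarith [hr.2]
      · push Not at hex
        filter_upwards [self_mem_nhdsWithin, mem_nhdsWithin_of_mem_nhds
          (Ioi_mem_nhds (show τ - δ < τ by linarith))] with r hr hra
        have hrT : r ∉ T := fun h => absurd (hex r h hra) (not_le.2 hr.2)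
        have hgap := mem_Ioo_floor hT hr.1 hrT
        have h1 : sigma T (floor T r) = τ := by
          refine le_antisymm (sigma_le hτT (hgap.1.trans hr.2)) ?_
          exact hex _ (sigma_mem hT _) (lt_trans hra hgap.2)
        rw [← hσ _ (floor_mem hT r), h1, dist_self]
        exact hε
    · have hgap := mem_Ioo_floor hT hτ hτT
      refine ContinuousAt.continuousWithinAt
        (continuousAt_const.congr (f := fun _ => w (floor T τ)) ?_)
      filter_upwards [Ioo_mem_nhds hgap.1 hgap.2] with r hr
      rw [floor_eq_of_mem_Ico hT (floor_mem hT τ) (Ioo_subset_Ico_self hr)]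
  have hcont : ContinuousOn (fun τ => w (floor T τ)) (Icc 0 b) := by
    intro τ hτ
    refine ((hleft τ hτ.1).union (hright τ hτ.1).continuousWithinAt).mono fun r hr => ?_
    rcases lt_or_ge r τ with h | h
    · exact Or.inl ⟨hr.1, h⟩
    · exact Or.inr h
  have := constant_of_has_deriv_right_zero hcont (fun τ hτ => hright τ hτ.1) b
    ⟨hT.subset_nonneg hb, le_rfl⟩
  simpa only [floor_of_mem hT hb, floor_of_mem hT hT.zero_mem] using this

/-- The mean of `h` over the segment from `p` to `q`; its value is `h p` when `p = q`. -/
noncomputable def segmentMean (h : ℝ → E) (p q : ℝ) : E := ∫ θ in (0 : ℝ)..1, h (p + θ * (q - p))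

theorem continuous_segmentMean {h : ℝ → E} (hh : Continuous h) :
    Continuous fun p : ℝ × ℝ => segmentMean h p.1 p.2 :=
  intervalIntegral.continuous_parametric_intervalIntegral_of_continuous'
    (f := fun (p : ℝ × ℝ) (θ : ℝ) => h (p.1 + θ * (p.2 - p.1))) (by fun_prop) 0 1

theorem sub_smul_segmentMean (h : ℝ → E) (p q : ℝ) :
    (q - p) • segmentMean h p q = ∫ v in p..q, h v := by
  have := intervalIntegral.smul_integral_comp_add_mul (a := 0) (b := 1) h (q - p) p
  simp only [mul_zero, add_zero, mul_one, add_sub_cancel] at this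
  rw [← this, segmentMean]
  simp only [mul_comm]

variable [CompleteSpace E]

/-- Bounded solvability along `T` gives bounded solvability along the new time. A right-hand side
`Q h` in the new time, averaged over the gaps, becomes an rd-continuous right-hand side on `T`; by
variation of constants the solution on `T` is `Q (s t) (ξ + ∫₀^{s t} h)`. -/
theorem exists_bounded_of_solvable (hT : IsTimeScale T) (hs : IsSyndetic T)
    {Q a : ℝ → E →L[ℝ] E} {K : ℝ} (hK : 0 ≤ K) (hQc : Continuous Q)
    (hQu : ∀ v, 0 ≤ v → IsUnit (Q v))
    (hgrow : ∀ ξ u v, 0 ≤ u → 0 ≤ v → ‖Q v ξ‖ ≤ Real.exp (K * |v - u|) * ‖Q u ξ‖)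
    (hQd : ∀ t ∈ T, mu T t = 0 →
      HasDerivWithinAt (fun t => Q (newTime T t)) (a t * Q (newTime T t)) T t)
    (hQσ : ∀ t ∈ T, Q (newTime T (sigma T t)) = (1 + mu T t • a t) * Q (newTime T t))
    (hsolv : ∀ f : ℝ → E, RdContinuous T f → BoundedOn T f →
      ∃ x : ℝ → E, (∀ t ∈ T, HasDeltaDeriv T x (a t (x t) + f t) t) ∧ BoundedOn T x)
    {h : ℝ → E} (hh : Continuous h) {C : ℝ} (hC : ∀ v, 0 ≤ v → ‖Q v (h v)‖ ≤ C) :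
    ∃ (ξ : E) (D : ℝ), ∀ v, 0 ≤ v → ‖Q v (ξ + ∫ r in (0 : ℝ)..v, h r)‖ ≤ D := by
  obtain ⟨M, hM0, hM⟩ := exists_mu_bound hT hs
  have hC0 : 0 ≤ C := (norm_nonneg _).trans (hC 0 le_rfl)
  have hs0 : ∀ t ∈ T, 0 ≤ newTime T t := fun t ht => newTime_nonneg hT hs (hT.subset_nonneg ht)
  have hsm := (strictMono_newTime hT hs).monotone
  have hgap : ∀ t ∈ T, newTime T (sigma T t) - newTime T t ≤ M := fun t ht =>
    (newTime_sub_le hT (le_sigma hT t)).trans (hM t ht)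
  -- Moving `h r` to a later time at distance at most `M`.
  have hmove : ∀ r v, 0 ≤ r → r ≤ v → v - r ≤ M → ‖Q v (h r)‖ ≤ Real.exp (K * M) * C := by
    intro r v hr hrv hrM
    refine (hgrow (h r) r v hr (hr.trans hrv)).trans ?_
    rw [abs_of_nonneg (by linarith)]
    gcongr
    exact hC r hr
  -- One formula for both kinds of points: at a right-dense point it reads `Q (s t) (h (s t))`, and
  -- across a gap `μ f` is `Q (s (σ t))` applied to the integral of `h` over the image of the gap.
  set f : ℝ → E := fun t => rate (mu T t) •
    Q (newTime T (sigma T t)) (segmentMean h (newTime T t) (newTime T (sigma T t))) with hf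
  have hflim : ∀ (l : Filter ℝ) (t : ℝ), Tendsto id l (𝓝 t) → Tendsto (sigma T) l (𝓝 t) →
      Tendsto f l (𝓝 ((1 : ℝ) • Q (newTime T t) (segmentMean h (newTime T t) (newTime T t)))) := by
    intro l t h1 h2
    have hsc := (continuous_newTime hT).tendsto t
    have h3 := (hsc.comp h1).prodMk_nhds (hsc.comp h2)
    have h4 := ((continuous_segmentMean hh).tendsto _).comp h3
    have h5 := (hQc.tendsto _).comp (hsc.comp h2)
    have h6 := ((isBoundedBilinearMap_apply (𝕜 := ℝ) (E := E) (F := E)).continuous.tendsto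
      (Q (newTime T t), segmentMean h (newTime T t) (newTime T t))).comp (h5.prodMk_nhds h4)
    exact (tendsto_rate_zero.comp (tendsto_mu_of_tendsto_sigma h1 h2)).smul h6
  have hfrd : RdContinuous T f := by
    refine fun t ht => ⟨fun hd => ?_, fun _ => ⟨_, hflim _ t
      (tendsto_id.mono_left nhdsWithin_le_nhds) (tendsto_sigma_of_leftDense hT ht)⟩⟩
    have h1 := hflim _ t (tendsto_id.mono_left nhdsWithin_le_nhds)
      (tendsto_sigma_of_rightDense hT hd)
    have h2 : f t = (1 : ℝ) • Q (newTime T t) (segmentMean h (newTime T t) (newTime T t)) := by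
      have hst : sigma T t = t := sub_eq_zero.1 hd
      simp only [hf, hst, hd, rate, if_true]
    rw [ContinuousWithinAt, h2]
    exact h1
  have hfb : BoundedOn T f := by
    refine ⟨Real.exp (K * M) * C, fun t ht => ?_⟩
    have hle := hsm (le_sigma hT t)
    have hg := hgap t ht
    have h1 : ‖Q (newTime T (sigma T t))
        (segmentMean h (newTime T t) (newTime T (sigma T t)))‖ ≤ Real.exp (K * M) * C := by
      rw [segmentMean, ← (Q (newTime T (sigma T t))).intervalIntegral_comp_comm
        (Continuous.intervalIntegrable (by fun_prop) _ _)]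
      have := intervalIntegral.norm_integral_le_of_norm_le_const (a := 0) (b := 1)
        (f := fun θ => Q (newTime T (sigma T t))
          (h (newTime T t + θ * (newTime T (sigma T t) - newTime T t))))
        (C := Real.exp (K * M) * C) (fun θ hθ => by
          rw [uIoc_of_le zero_le_one] at hθ
          have h2 : 0 ≤ θ * (newTime T (sigma T t) - newTime T t) :=
            mul_nonneg hθ.1.le (by linarith)
          have h3 : θ * (newTime T (sigma T t) - newTime T t) ≤
              newTime T (sigma T t) - newTime T t :=
            mul_le_of_le_one_left (by linarith) hθ.2
          exact hmove _ _ (by linarith [hs0 t ht]) (by linarith) (by linarith))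
      simpa using this
    simp only [hf]
    rw [norm_smul, Real.norm_of_nonneg (rate_pos (mu_nonneg hT t)).le]
    exact (mul_le_of_le_one_left (norm_nonneg _) (rate_le_one (mu_nonneg hT t))).trans h1
  obtain ⟨x, hx, Cx, hCx⟩ := hsolv f hfrd hfb
  set H : ℝ → E := fun v => ∫ r in (0 : ℝ)..v, h r with hH
  have hHd : ∀ v, HasDerivAt H (h v) v := fun v =>
    intervalIntegral.integral_hasDerivAt_right (hh.intervalIntegrable _ _)
      (hh.stronglyMeasurableAtFilter _ _) hh.continuousAt
  have hHsub : ∀ u v, H v - H u = ∫ r in u..v, h r := fun u v =>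
    intervalIntegral.integral_interval_sub_left (hh.intervalIntegrable _ _)
      (hh.intervalIntegrable _ _)
  have hinvl : ∀ v, 0 ≤ v → ∀ e, Ring.inverse (Q v) (Q v e) = e := fun v hv e => by
    rw [← mul_apply_eq_comp, Ring.inverse_mul_cancel _ (hQu v hv)]; rfl
  have hinvr : ∀ v, 0 ≤ v → ∀ e, Q v (Ring.inverse (Q v) e) = e := fun v hv e => by
    rw [← mul_apply_eq_comp, Ring.mul_inverse_cancel _ (hQu v hv)]; rfl
  set w : ℝ → E := fun t => Ring.inverse (Q (newTime T t)) (x t) - H (newTime T t) with hw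
  have hwσ : ∀ t ∈ T, w (sigma T t) = w t := by
    intro t ht
    have hσ0 := hs0 _ (sigma_mem hT t)
    have h1 : mu T t • f t = Q (newTime T (sigma T t)) (H (newTime T (sigma T t)) -
        H (newTime T t)) := by
      rw [hHsub, ← sub_smul_segmentMean, newTime_sigma_sub hT ht, map_smul,
        ← rate_mul_self (mu T t)]
      simp only [hf]
      rw [smul_smul, mul_comm]
    have h2 : x (sigma T t) = Q (newTime T (sigma T t)) (Ring.inverse (Q (newTime T t)) (x t) +
        (H (newTime T (sigma T t)) - H (newTime T t))) := by
      rw [(hx t ht).apply_sigma ht, map_add, ← h1, hQσ t ht, mul_apply_eq_comp,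
        hinvr _ (hs0 t ht), smul_add]
      simp [add_assoc]
    simp only [hw]
    rw [h2, hinvl _ hσ0]
    abel
  have hinvd : ∀ (v : ℝ), 0 ≤ v → HasFDerivAt Ring.inverse
      (-((ContinuousLinearMap.mulLeftRight ℝ (E →L[ℝ] E)) (Ring.inverse (Q v)))
        (Ring.inverse (Q v))) (Q v) := by
    intro v hv
    obtain ⟨u, hu⟩ := hQu v hv
    rw [← hu, Ring.inverse_unit]
    exact hasFDerivAt_ringInverse u
  have hwd : ∀ t ∈ T, mu T t = 0 → HasDerivWithinAt w 0 T t := by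
    intro t ht hd
    have hst : sigma T t = t := sub_eq_zero.1 hd
    have h1 := (hinvd _ (hs0 t ht)).comp_hasDerivWithinAt
      (f := fun t => Q (newTime T t)) t (hQd t ht hd)
    have h2 := h1.clm_apply ((hx t ht).hasDerivWithinAt hd)
    have h3 := (hHd (newTime T t)).scomp_hasDerivWithinAt t (hasDerivWithinAt_newTime hT ht hd)
    have hft : f t = Q (newTime T t) (h (newTime T t)) := by
      have hsm : segmentMean h (newTime T t) (newTime T t) = h (newTime T t) := by
        simp [segmentMean]
      simp only [hf, hst, hd, rate, if_true, hsm, one_smul]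
    refine (h2.sub h3).congr_deriv ?_
    simp only [hft, one_smul, Function.comp_apply, neg_apply,
      ContinuousLinearMap.mulLeftRight_apply, mul_apply_eq_comp, map_add,
      hinvr _ (hs0 t ht), hinvl _ (hs0 t ht)]
    abel
  have hwc : ∀ t ∈ T, ContinuousWithinAt w T t := by
    intro t ht
    have h1 : ContinuousAt (fun t => Ring.inverse (Q (newTime T t))) t :=
      (hinvd _ (hs0 t ht)).continuousAt.comp
        (f := fun t => Q (newTime T t)) (hQc.comp (continuous_newTime hT)).continuousAt
    exact (h1.continuousWithinAt.clm_apply ((hx t ht).continuousWithinAt ht)).sub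
      (((hHd _).continuousAt.comp (continuous_newTime hT).continuousAt).continuousWithinAt)
  have hwconst : ∀ t ∈ T, w t = w 0 := fun t ht => eq_of_deltaDeriv_zero hT hwσ hwd hwc ht
  have hxQ : ∀ t ∈ T, x t = Q (newTime T t) (w 0 + H (newTime T t)) := by
    intro t ht
    rw [← hwconst t ht]
    simp only [hw, sub_add_cancel]
    rw [hinvr _ (hs0 t ht)]
  refine ⟨w 0, Real.exp (K * M) * |Cx| + Real.exp (K * M) * C * M, fun v hv => ?_⟩
  obtain ⟨τ, rfl⟩ := surjective_newTime hT hs v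
  have hτ0 : 0 ≤ τ := by
    rw [← newTime_zero (T := T)] at hv
    exact (strictMono_newTime hT hs).le_iff_le.1 hv
  obtain ⟨haT, haτ⟩ := floor_mem_le hT hτ0
  set b := floor T τ
  have hbτ : newTime T b ≤ newTime T τ := hsm haτ
  have hlen : newTime T τ - newTime T b ≤ M := by
    by_cases hτT : τ ∈ T
    · have : b = τ := floor_of_mem hT hτT
      rw [this, sub_self]; exact hM0
    · have h1 := hsm (mem_Ioo_floor hT hτ0 hτT).2.le
      linarith [hgap b haT]
  have hsplit : w 0 + H (newTime T τ) = (w 0 + H (newTime T b)) +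
      ∫ r in (newTime T b)..(newTime T τ), h r := by
    rw [← hHsub]; abel
  change ‖Q (newTime T τ) (w 0 + H (newTime T τ))‖ ≤ _
  rw [hsplit, map_add]
  refine (norm_add_le _ _).trans (add_le_add ?_ ?_)
  · refine (hgrow _ (newTime T b) _ (hs0 b haT) hv).trans ?_
    rw [← hxQ b haT, abs_of_nonneg (by linarith)]
    gcongr
    exact (hCx b haT).trans (le_abs_self Cx)
  · rw [← (Q (newTime T τ)).intervalIntegral_comp_comm (hh.intervalIntegrable _ _)]
    have := intervalIntegral.norm_integral_le_of_norm_le_const (a := newTime T b)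
      (b := newTime T τ) (f := fun r => Q (newTime T τ) (h r)) (C := Real.exp (K * M) * C)
      (fun r hr => by
        rw [uIoc_of_le hbτ] at hr
        exact hmove r _ ((hs0 b haT).trans hr.1.le) hr.2 (by linarith [hr.1]))
    refine this.trans ?_
    rw [abs_of_nonneg (by linarith)]
    gcongr

end TimeScale

/-! ### Complexification -/

section Complexification

variable {n : ℕ}

/-- The action of complex matrices on `ℂⁿ`, with scalars restricted to `ℝ`. -/
noncomputable def realAction (n : ℕ) : Matrix (Fin n) (Fin n) ℂ →ₐ[ℝ]
    (EuclideanSpace ℂ (Fin n) →L[ℝ] EuclideanSpace ℂ (Fin n)) where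
  toFun M := (Matrix.toEuclideanCLM (𝕜 := ℂ) (n := Fin n) M).restrictScalars ℝ
  map_one' := by rw [map_one]; rfl
  map_mul' M N := by rw [map_mul]; rfl
  map_zero' := by rw [map_zero]; rfl
  map_add' M N := by rw [map_add]; rfl
  commutes' r := by
    ext1 x
    have h : algebraMap ℝ (Matrix (Fin n) (Fin n) ℂ) r = (r : ℂ) • 1 := by
      rw [Algebra.algebraMap_eq_smul_one, Complex.coe_smul]
    rw [h, map_smul, map_one, Algebra.algebraMap_eq_smul_one]
    exact Complex.coe_smul r x

theorem realAction_apply (M : Matrix (Fin n) (Fin n) ℂ) (x : EuclideanSpace ℂ (Fin n)) :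
    realAction n M x = Matrix.toEuclideanCLM (𝕜 := ℂ) (n := Fin n) M x := rfl

/-- The entrywise map `v ↦ c v` from `ℝⁿ` to `ℂⁿ`. -/
noncomputable def scaledInclusion (n : ℕ) (c : ℂ) :
    EuclideanSpace ℝ (Fin n) →L[ℝ] EuclideanSpace ℂ (Fin n) :=
  LinearMap.toContinuousLinearMap
    { toFun := fun v => WithLp.toLp 2 fun i => c * (v i : ℂ)
      map_add' := fun v w => by ext i; simp [mul_add]
      map_smul' := fun r v => by ext i; simp [mul_left_comm] }

/-- The entrywise application of a real linear functional on `ℂ` to vectors of `ℂⁿ`. -/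
noncomputable def entrywiseReal (n : ℕ) (φ : ℂ →ₗ[ℝ] ℝ) :
    EuclideanSpace ℂ (Fin n) →L[ℝ] EuclideanSpace ℝ (Fin n) :=
  LinearMap.toContinuousLinearMap
    { toFun := fun v => WithLp.toLp 2 fun i => φ (v i)
      map_add' := fun v w => by ext i; simp
      map_smul' := fun r v => by ext i; exact φ.map_smul r (v i) }

theorem realAction_complexify_scaledInclusion (c : ℂ) (X : Matrix (Fin n) (Fin n) ℝ)
    (v : EuclideanSpace ℝ (Fin n)) :
    realAction n (complexify n X) (scaledInclusion n c v) =
      scaledInclusion n c (Matrix.toEuclideanLin X v) := by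
  ext i
  change ∑ j, (X i j : ℂ) * (c * (v j : ℂ)) = c * ((∑ j, X i j * v j : ℝ) : ℂ)
  push_cast
  rw [Finset.mul_sum]
  exact Finset.sum_congr rfl fun j _ => by ring

theorem scaledInclusion_re_add_im (v : EuclideanSpace ℂ (Fin n)) :
    scaledInclusion n 1 (entrywiseReal n Complex.reLm v) +
      scaledInclusion n Complex.I (entrywiseReal n Complex.imLm v) = v := by
  ext i
  change 1 * ((v i).re : ℂ) + Complex.I * ((v i).im : ℂ) = v i
  rw [one_mul, mul_comm]
  exact Complex.re_add_im _

namespace TimeScale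

theorem RdContinuous.continuous_comp {T : Set ℝ} {E F : Type*} [TopologicalSpace E]
    [TopologicalSpace F] {f : ℝ → E} (hf : RdContinuous T f) {φ : E → F} (hφ : Continuous φ) :
    RdContinuous T fun t => φ (f t) := fun t ht =>
  ⟨fun hd => hφ.continuousAt.comp_continuousWithinAt ((hf t ht).1 hd), fun hl =>
    let ⟨l, h⟩ := (hf t ht).2 hl
    ⟨φ l, (hφ.tendsto l).comp h⟩⟩

theorem BoundedOn.clm_comp {T : Set ℝ} {E F : Type*} [NormedAddCommGroup E] [NormedSpace ℝ E]
    [NormedAddCommGroup F] [NormedSpace ℝ F] {f : ℝ → E} (hf : BoundedOn T f) (φ : E →L[ℝ] F) :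
    BoundedOn T fun t => φ (f t) := by
  obtain ⟨C, hC⟩ := hf
  exact ⟨‖φ‖ * C, fun t ht => (φ.le_opNorm _).trans
    (mul_le_mul_of_nonneg_left (hC t ht) (norm_nonneg _))⟩

/-- Solving for real and imaginary parts gives bounded solvability of the complexified system. -/
theorem exists_complex_solution {T : Set ℝ} {A : ℝ → Matrix (Fin n) (Fin n) ℝ}
    (hsolv : ∀ f : ℝ → EuclideanSpace ℝ (Fin n), RdContinuous T f → BoundedOn T f →
      ∃ x : ℝ → EuclideanSpace ℝ (Fin n), IsSolution T A f x ∧ BoundedOn T x)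
    (f : ℝ → EuclideanSpace ℂ (Fin n)) (hf : RdContinuous T f) (hfb : BoundedOn T f) :
    ∃ x : ℝ → EuclideanSpace ℂ (Fin n),
      (∀ t ∈ T, HasDeltaDeriv T x (realAction n (complexify n (A t)) (x t) + f t) t) ∧
        BoundedOn T x := by
  obtain ⟨x₁, hx₁, hb₁⟩ := hsolv (fun t => entrywiseReal n Complex.reLm (f t))
    (hf.continuous_comp (entrywiseReal n _).continuous) (hfb.clm_comp _)
  obtain ⟨x₂, hx₂, hb₂⟩ := hsolv (fun t => entrywiseReal n Complex.imLm (f t))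
    (hf.continuous_comp (entrywiseReal n _).continuous) (hfb.clm_comp _)
  refine ⟨fun t => scaledInclusion n 1 (x₁ t) + scaledInclusion n Complex.I (x₂ t),
    fun t ht => ?_, ?_⟩
  · have h := ((hx₁ t ht).clm_comp (scaledInclusion n 1)).add
      ((hx₂ t ht).clm_comp (scaledInclusion n Complex.I))
    convert h using 1
    rw [map_add, map_add, map_add, realAction_complexify_scaledInclusion,
      realAction_complexify_scaledInclusion]
    conv_lhs => rw [← scaledInclusion_re_add_im (f t)]
    abel
  · obtain ⟨C₁, h₁⟩ := hb₁.clm_comp (scaledInclusion n 1)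
    obtain ⟨C₂, h₂⟩ := hb₂.clm_comp (scaledInclusion n Complex.I)
    exact ⟨C₁ + C₂, fun t ht => (norm_add_le _ _).trans (add_le_add (h₁ t ht) (h₂ t ht))⟩

end TimeScale

end Complexification

/-! ### Sampling at the integers -/

section Discretization

variable {E : Type*} [NormedAddCommGroup E] [NormedSpace ℝ E]

theorem sin_pi_mul_nat (k : ℕ) : Real.sin (Real.pi * k) = 0 := by
  rw [mul_comm]; exact Real.sin_nat_mul_pi k

/-- The weight `2 sin² (π v)` vanishes at the integers, so a sequence of coefficients on the unit
intervals is interpolated continuously. -/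
theorem continuous_sin_sq_smul_floor (c : ℕ → E) :
    Continuous fun v : ℝ => (2 * Real.sin (Real.pi * v) ^ 2) • c ⌊v⌋₊ := by
  have hw : Continuous fun v : ℝ => 2 * Real.sin (Real.pi * v) ^ 2 := by fun_prop
  have hlc : ∀ (v : ℝ) (U : Set ℝ), U ∈ 𝓝 v → (∀ r ∈ U, ⌊r⌋₊ = ⌊v⌋₊) →
      ContinuousAt (fun v : ℝ => (2 * Real.sin (Real.pi * v) ^ 2) • c ⌊v⌋₊) v := by
    intro v U hU hUv
    refine ContinuousAt.congr (hw.smul (continuous_const (y := c ⌊v⌋₊))).continuousAt ?_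
    filter_upwards [hU] with r hr
    rw [hUv r hr]
    rfl
  refine continuous_iff_continuousAt.2 fun v => ?_
  rcases lt_or_ge v 1 with hv1 | hv1
  · refine hlc v (Iio 1) (Iio_mem_nhds hv1) fun r hr => ?_
    rw [Nat.floor_eq_zero.2 hr, Nat.floor_eq_zero.2 hv1]
  have hv0 : 0 ≤ v := by linarith
  rcases (Nat.floor_le hv0).eq_or_lt with hv | hv
  · have hz : 2 * Real.sin (Real.pi * v) ^ 2 = 0 := by
      rw [← hv, sin_pi_mul_nat]; norm_num
    rw [ContinuousAt, hz, zero_smul]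
    have hb : ∀ᶠ r in 𝓝 v, ‖c ⌊r⌋₊‖ ≤ ∑ i ∈ Finset.range (⌊v⌋₊ + 2), ‖c i‖ := by
      filter_upwards [Iio_mem_nhds (show v < v + 1 by linarith)] with r hr
      refine Finset.single_le_sum (f := fun i => ‖c i‖) (fun i _ => norm_nonneg _) ?_
      rw [Finset.mem_range]
      have := Nat.floor_mono (le_of_lt (show r < v + 1 from hr))
      rw [Nat.floor_add_one hv0] at this
      omega
    have hwz : Tendsto (fun v : ℝ => 2 * Real.sin (Real.pi * v) ^ 2) (𝓝 v) (𝓝 0) := by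
      have := hw.tendsto v
      rwa [hz] at this
    exact hwz.zero_smul_isBoundedUnder_le (isBoundedUnder_of_eventually_le hb)
  · refine hlc v (Ioo ⌊v⌋₊ (⌊v⌋₊ + 1)) (Ioo_mem_nhds hv (Nat.lt_floor_add_one v)) fun r hr => ?_
    rw [Nat.floor_eq_iff ((Nat.cast_nonneg _).trans hr.1.le)]
    exact ⟨hr.1.le, hr.2⟩

theorem integral_sin_sq_smul_floor [CompleteSpace E] (c : ℕ → E) (k : ℕ) :
    ∫ v in (k : ℝ)..(k + 1 : ℝ), (2 * Real.sin (Real.pi * v) ^ 2) • c ⌊v⌋₊ = c k := by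
  have h1 : ∫ v in (k : ℝ)..(k + 1 : ℝ), (2 * Real.sin (Real.pi * v) ^ 2) • c ⌊v⌋₊ =
      ∫ v in (k : ℝ)..(k + 1 : ℝ), (2 * Real.sin (Real.pi * v) ^ 2) • c k := by
    refine intervalIntegral.integral_congr_ae ?_
    have : ∀ᵐ s : ℝ, s ≠ (k + 1 : ℝ) := Measure.ae_ne volume _
    filter_upwards [this] with s hs hs'
    rw [uIoc_of_le (by linarith)] at hs'
    have : ⌊s⌋₊ = k := by
      rw [Nat.floor_eq_iff ((Nat.cast_nonneg _).trans hs'.1.le)]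
      exact ⟨hs'.1.le, lt_of_le_of_ne hs'.2 hs⟩
    rw [this]
  have h2 : ∫ v in (k : ℝ)..(k + 1 : ℝ), (2 * Real.sin (Real.pi * v) ^ 2) = 1 := by
    have hd : ∀ v ∈ uIcc (k : ℝ) (k + 1), HasDerivAt
        (fun v : ℝ => v - Real.sin (2 * (Real.pi * v)) / (2 * Real.pi))
        (2 * Real.sin (Real.pi * v) ^ 2) v := by
      intro v _
      have h3 : HasDerivAt (fun v : ℝ => 2 * (Real.pi * v)) (2 * Real.pi) v := by
        simpa using ((hasDerivAt_id v).const_mul Real.pi).const_mul 2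
      refine ((hasDerivAt_id v).sub (h3.sin.div_const (2 * Real.pi))).congr_deriv ?_
      rw [Real.sin_sq_eq_half_sub]
      field_simp
    rw [intervalIntegral.integral_eq_sub_of_hasDerivAt hd
      (Continuous.intervalIntegrable (by fun_prop) _ _)]
    have h4 : Real.sin (2 * (Real.pi * (k : ℝ))) = 0 := by
      rw [Real.sin_two_mul, sin_pi_mul_nat]; ring
    have h5 : Real.sin (2 * (Real.pi * (k + 1 : ℝ))) = 0 := by
      have := sin_pi_mul_nat (k + 1)
      push_cast at this
      rw [Real.sin_two_mul, this]; ring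
    rw [h4, h5]
    ring
  rw [h1, intervalIntegral.integral_smul_const, h2, one_smul]

end Discretization

/-- A dichotomy of the solution sampled at the integers is a dichotomy at all times, since over
unit intervals solutions change by at most the factor `e^K`. -/
theorem dichotomy_of_nat {E : Type*} [NormedAddCommGroup E] {q : ℝ → E → E} {K C lam : ℝ}
    (hK : 0 ≤ K) (hC : 0 < C) (hlam : 0 < lam)
    (hgrow : ∀ ξ u v, 0 ≤ u → 0 ≤ v → ‖q v ξ‖ ≤ Real.exp (K * |v - u|) * ‖q u ξ‖) {ξ : E}
    {τ t : ℝ} (hτ : 0 ≤ τ) (hτt : τ ≤ t) :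
    ((∀ m k : ℕ, m ≤ k → ‖q k ξ‖ ≤ C * Real.exp (-lam * (k - m : ℝ)) * ‖q m ξ‖) →
      ‖q t ξ‖ ≤ Real.exp K * (C * Real.exp lam) * Real.exp K * Real.exp (-lam * (t - τ)) *
        ‖q τ ξ‖) ∧
    ((∀ m k : ℕ, m ≤ k → ‖q m ξ‖ ≤ C * Real.exp (-lam * (k - m : ℝ)) * ‖q k ξ‖) →
      ‖q τ ξ‖ ≤ Real.exp K * (C * Real.exp lam) * Real.exp K * Real.exp (-lam * (t - τ)) *
        ‖q t ξ‖) := by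
  have ht : 0 ≤ t := hτ.trans hτt
  have hnear : ∀ r : ℝ, 0 ≤ r → ‖q r ξ‖ ≤ Real.exp K * ‖q ⌊r⌋₊ ξ‖ ∧
      ‖q ⌊r⌋₊ ξ‖ ≤ Real.exp K * ‖q r ξ‖ := by
    intro r hr
    have h1 := Nat.floor_le hr
    have h2 := Nat.lt_floor_add_one r
    have h3 : |r - ⌊r⌋₊| ≤ 1 := by rw [abs_le]; constructor <;> linarith
    have h4 : |(⌊r⌋₊ : ℝ) - r| ≤ 1 := by rwa [abs_sub_comm]
    have h5 : ∀ y : ℝ, |y| ≤ 1 → K * |y| ≤ K := fun y hy =>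
      mul_le_of_le_one_right hK hy
    exact ⟨(hgrow ξ _ _ (Nat.cast_nonneg _) hr).trans (by gcongr; exact h5 _ h3),
      (hgrow ξ _ _ hr (Nat.cast_nonneg _)).trans (by gcongr; exact h5 _ h4)⟩
  have hmk : ⌊τ⌋₊ ≤ ⌊t⌋₊ := Nat.floor_mono hτt
  have hexp : Real.exp (-lam * (⌊t⌋₊ - ⌊τ⌋₊ : ℝ)) ≤ Real.exp lam * Real.exp (-lam * (t - τ)) := by
    rw [← Real.exp_add]
    refine Real.exp_le_exp.2 ?_
    have h1 := Nat.floor_le hτ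
    have h2 := Nat.lt_floor_add_one t
    nlinarith
  have hchain : ∀ a b c d : ℝ, 0 ≤ d → a ≤ Real.exp K * b →
      b ≤ C * Real.exp (-lam * (⌊t⌋₊ - ⌊τ⌋₊ : ℝ)) * c → c ≤ Real.exp K * d →
      a ≤ Real.exp K * (C * Real.exp lam) * Real.exp K * Real.exp (-lam * (t - τ)) * d := by
    intro a b c d hd hab hbc hcd
    calc a ≤ Real.exp K * (C * Real.exp (-lam * (⌊t⌋₊ - ⌊τ⌋₊ : ℝ)) * (Real.exp K * d)) := by
          refine hab.trans ?_
          gcongr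
          exact hbc.trans (by gcongr)
      _ ≤ Real.exp K * (C * (Real.exp lam * Real.exp (-lam * (t - τ))) * (Real.exp K * d)) := by
          gcongr
      _ = _ := by ring
  exact ⟨fun h => hchain _ _ _ _ (norm_nonneg _) (hnear t ht).1 (h _ _ hmk) (hnear τ hτ).2,
    fun h => hchain _ _ _ _ (norm_nonneg _) (hnear τ hτ).1 (h _ _ hmk) (hnear t ht).2⟩

/-! ### Hyperbolicity -/

namespace TimeScale

variable {n : ℕ}

/-- In dimension zero the norm of the identity matrix is `0`, so only an inequality holds. -/
theorem norm_one_matrix_le : ‖(1 : Matrix (Fin n) (Fin n) ℂ)‖ ≤ 1 := by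
  rcases isEmpty_or_nonempty (Fin n) with h | h
  · rw [Subsingleton.elim (1 : Matrix (Fin n) (Fin n) ℂ) 0, norm_zero]; exact zero_le_one
  · exact (CStarRing.norm_one (E := Matrix (Fin n) (Fin n) ℂ)).le

/-- For each matrix logarithm, the solution operators sampled at integer times satisfy the
hypotheses of Perron's theorem for difference equations; the resulting splitting at time `0` is
transported by the solution operators. -/
theorem isHyperbolicODE_odeCoeff {T : Set ℝ} (hT : IsTimeScale T) (hs : IsSyndetic T)
    {A : ℝ → Matrix (Fin n) (Fin n) ℝ} (hAc : RdContinuous T A) (hA : BoundedOn T A)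
    (hreg : UniformlyRegressive T A)
    (hsolv : ∀ f : ℝ → EuclideanSpace ℝ (Fin n), RdContinuous T f → BoundedOn T f →
      ∃ x : ℝ → EuclideanSpace ℝ (Fin n), IsSolution T A f x ∧ BoundedOn T x)
    {L : Matrix (Fin n) (Fin n) ℂ → Matrix (Fin n) (Fin n) ℂ} (hL : IsMatrixLog n L) :
    IsHyperbolicODE (odeCoeff L T A) := by
  obtain ⟨Φ, K, hΦ, hfund, hK, hunit, hgrowM, hΦd, hΦσ⟩ :=
    exists_fundamentalMatrix hT hs hA hAc hreg hL
  set J := Matrix.toEuclideanCLM (𝕜 := ℂ) (n := Fin n) with hJ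
  have hinv : ∀ v, 0 ≤ v → (Φ v)⁻¹ * Φ v = 1 ∧ Φ v * (Φ v)⁻¹ = 1 := fun v hv =>
    have := (Matrix.isUnit_iff_isUnit_det _).1 (hunit v hv)
    ⟨Matrix.nonsing_inv_mul _ this, Matrix.mul_nonsing_inv _ this⟩
  have hgrow : ∀ (ξ : EuclideanSpace ℂ (Fin n)) (u v : ℝ), 0 ≤ u → 0 ≤ v →
      ‖J (Φ v) ξ‖ ≤ Real.exp (K * |v - u|) * ‖J (Φ u) ξ‖ := by
    intro ξ u v hu hv
    have h1 : J (Φ v) ξ = J (Φ v * (Φ u)⁻¹) (J (Φ u) ξ) := by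
      rw [← mul_apply_eq_comp, ← map_mul, mul_assoc, (hinv u hu).1, mul_one]
    have h2 : ‖J (Φ v * (Φ u)⁻¹)‖ ≤ Real.exp (K * |v - u|) := by
      change ‖Φ v * (Φ u)⁻¹‖ ≤ _
      refine (hgrowM (Φ u)⁻¹ u v hu hv).trans ?_
      rw [(hinv u hu).2]
      exact mul_le_of_le_one_right (Real.exp_pos _).le norm_one_matrix_le
    rw [h1]
    exact ((J _).le_opNorm _).trans (by gcongr)
  have hRc : Continuous (realAction n) :=
    (realAction n).toLinearMap.continuous_of_finiteDimensional
  have hbounded := fun h hh C hC => exists_bounded_of_solvable hT hs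
    (Q := fun v => realAction n (Φ v)) (a := fun t => realAction n (complexify n (A t))) hK
    (hRc.comp hΦ) (fun v hv => (hunit v hv).map _) hgrow
    (fun t ht hd => by
      have := (LinearMap.toContinuousLinearMap
        (realAction n).toLinearMap).hasFDerivAt.comp_hasDerivWithinAt t (hΦd t ht hd)
      simp only [LinearMap.coe_toContinuousLinearMap', AlgHom.toLinearMap_apply, map_mul] at this
      exact this)
    (fun t ht => by
      rw [hΦσ t ht, map_mul, map_add, map_one, map_smul])
    (exists_complex_solution hsolv) (h := h) hh (C := C) hC
  -- The solution operators as linear equivalences.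
  have heq : ∀ v, ∃ e : EuclideanSpace ℂ (Fin n) ≃L[ℂ] EuclideanSpace ℂ (Fin n),
      0 ≤ v → ∀ x, e x = J (Φ v) x := by
    intro v
    by_cases hv : 0 ≤ v
    · refine ⟨ContinuousLinearEquiv.equivOfInverse (J (Φ v)) (J (Φ v)⁻¹) (fun x => ?_)
        (fun x => ?_), fun _ x => rfl⟩
      · rw [← mul_apply_eq_comp, ← map_mul, (hinv v hv).1, map_one]; rfl
      · rw [← mul_apply_eq_comp, ← map_mul, (hinv v hv).2, map_one]; rfl
    · exact ⟨ContinuousLinearEquiv.refl _ _, fun h => absurd h hv⟩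
  choose e he using heq
  have hek : ∀ (k : ℕ) x, e k x = J (Φ k) x := fun k x => he k (Nat.cast_nonneg k) x
  have hstep : ∀ (k : ℕ) ξ, ‖e (k + 1 : ℕ) ξ‖ ≤ Real.exp K * ‖e k ξ‖ := by
    intro k ξ
    rw [hek, hek]
    have := hgrow ξ k (k + 1 : ℕ) (Nat.cast_nonneg _) (Nat.cast_nonneg _)
    simpa using this
  have hdisc : ∀ g : ℕ → EuclideanSpace ℂ (Fin n), (∃ C : ℝ, ∀ k, ‖g k‖ ≤ C) →
      ∃ y : ℕ → EuclideanSpace ℂ (Fin n), (∃ C : ℝ, ∀ k, ‖y k‖ ≤ C) ∧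
        ∀ k : ℕ, y (k + 1) = e (k + 1 : ℕ) ((e k).symm (y k)) + g k := by
    rintro g ⟨C, hC⟩
    have hC0 : 0 ≤ C := (norm_nonneg _).trans (hC 0)
    set c : ℕ → EuclideanSpace ℂ (Fin n) := fun k => (e (k + 1 : ℕ)).symm (g k) with hc
    set h : ℝ → EuclideanSpace ℂ (Fin n) :=
      fun v => (2 * Real.sin (Real.pi * v) ^ 2) • c ⌊v⌋₊ with hh
    have hhc : Continuous h := continuous_sin_sq_smul_floor c
    obtain ⟨ξ, D, hD⟩ := hbounded h hhc (2 * (Real.exp K * C)) (fun v hv => by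
      simp only [hh]
      rw [map_smul, norm_smul, Real.norm_of_nonneg (by positivity), realAction_apply, ← hJ]
      have h1 := hgrow (c ⌊v⌋₊) (⌊v⌋₊ + 1 : ℕ) v (Nat.cast_nonneg _) hv
      rw [← hek] at h1
      simp only [hc, ContinuousLinearEquiv.apply_symm_apply] at h1
      have h2 : |v - (⌊v⌋₊ + 1 : ℕ)| ≤ 1 := by
        have h3 := Nat.floor_le hv
        have h4 := Nat.lt_floor_add_one v
        push_cast
        rw [abs_le]; constructor <;> linarith
      have h5 : Real.sin (Real.pi * v) ^ 2 ≤ 1 := Real.sin_sq_le_one _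
      have h6 : K * |v - (⌊v⌋₊ + 1 : ℕ)| ≤ K := mul_le_of_le_one_right hK h2
      have h7 : ‖J (Φ v) (c ⌊v⌋₊)‖ ≤ Real.exp K * C :=
        h1.trans (by gcongr; exact hC _)
      exact mul_le_mul (by linarith) h7 (norm_nonneg _) (by norm_num))
    refine ⟨fun k => e k (ξ + ∫ r in (0 : ℝ)..k, h r), ⟨D, fun k => ?_⟩, fun k => ?_⟩
    · simp only [hek]; exact hD k (Nat.cast_nonneg k)
    · have h1 : ∫ r in (0 : ℝ)..(k + 1 : ℕ), h r = (∫ r in (0 : ℝ)..k, h r) + c k := by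
        rw [← integral_sin_sq_smul_floor c k, Nat.cast_add, Nat.cast_one]
        exact (intervalIntegral.integral_add_adjacent_intervals (hhc.intervalIntegrable _ _)
          (hhc.intervalIntegrable _ _)).symm
      simp only [h1, ← add_assoc, map_add, ContinuousLinearEquiv.symm_apply_apply, hc,
        ContinuousLinearEquiv.apply_symm_apply]
  obtain ⟨U, V, hUV, C, hC, lam, hlam, hdich⟩ :=
    exists_dichotomy_of_solvable (Φ := fun k : ℕ => e k) hstep hdisc
  have hdich' := fun (ξ : EuclideanSpace ℂ (Fin n)) {τ t : ℝ} (hτ : 0 ≤ τ) (hτt : τ ≤ t) =>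
    dichotomy_of_nat (q := fun v ξ => J (Φ v) ξ) hK hC hlam hgrow (ξ := ξ) hτ hτt
  have hLin : ∀ (M : Matrix (Fin n) (Fin n) ℂ) x, Matrix.toEuclideanLin M x = J M x :=
    fun _ _ => rfl
  have htrans : ∀ t τ, 0 ≤ τ → ∀ ξ, Matrix.toEuclideanLin (Φ t * (Φ τ)⁻¹) (J (Φ τ) ξ) =
      J (Φ t) ξ := by
    intro t τ hτ ξ
    rw [hLin, ← mul_apply_eq_comp, ← map_mul, mul_assoc, (hinv τ hτ).1, mul_one]
  have hmap : ∀ (W : Submodule ℂ (EuclideanSpace ℂ (Fin n))) (t τ : ℝ), 0 ≤ τ →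
      (W.map (Matrix.toEuclideanLin (Φ τ))).map (Matrix.toEuclideanLin (Φ t * (Φ τ)⁻¹)) =
        W.map (Matrix.toEuclideanLin (Φ t)) := by
    intro W t τ hτ
    rw [← Submodule.map_comp]
    congr 1
    exact LinearMap.ext fun ξ => htrans t τ hτ ξ
  refine ⟨Φ, hfund, fun t => U.map (Matrix.toEuclideanLin (Φ t)),
    fun t => V.map (Matrix.toEuclideanLin (Φ t)),
    Real.exp K * (C * Real.exp lam) * Real.exp K, by positivity, lam, hlam, ?_, ?_, ?_, ?_⟩
  · intro t ht
    have h1 := (Submodule.orderIsoMapComap (e t).toLinearEquiv).isCompl hUV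
    have h2 : ((e t).toLinearEquiv : EuclideanSpace ℂ (Fin n) →ₗ[ℂ] EuclideanSpace ℂ (Fin n)) =
        Matrix.toEuclideanLin (Φ t) := LinearMap.ext fun ξ => he t ht ξ
    simp only [← h2]
    exact h1
  · exact fun t τ _ hτ => ⟨hmap U t τ hτ, hmap V t τ hτ⟩
  · rintro t τ hτ hτt _ ⟨ξ, hξ, rfl⟩
    rw [hLin (Φ τ), htrans t τ hτ]
    exact (hdich' ξ hτ hτt.le).1 fun m k hmk => by
      have := (hdich m k hmk).1 ξ hξ
      rwa [hek, hek] at this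
  · rintro t τ ht htτ _ ⟨ξ, hξ, rfl⟩
    rw [hLin (Φ τ), htrans t τ (ht.trans htτ.le), show lam * (t - τ) = -lam * (τ - t) by ring]
    exact (hdich' ξ ht htτ.le).2 fun m k hmk => by
      have := (hdich m k hmk).2 ξ hξ
      rwa [hek, hek] at this

end TimeScale

theorem theorem5p2 {n : ℕ} (T : Set ℝ) (hT : IsTimeScale T) (hsynd : TimeScale.IsSyndetic T)
    (A : ℝ → Matrix (Fin n) (Fin n) ℝ)
    (hAcont : TimeScale.RdContinuous T A)
    (hAbdd : TimeScale.BoundedOn T A)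
    (hAreg : TimeScale.UniformlyRegressive T A)
    (hsolv : ∀ f : ℝ → EuclideanSpace ℝ (Fin n),
      TimeScale.RdContinuous T f → TimeScale.BoundedOn T f →
        ∃ x : ℝ → EuclideanSpace ℝ (Fin n),
          TimeScale.IsSolution T A f x ∧ TimeScale.BoundedOn T x) :
    TimeScale.IsHyperbolic T A :=
  ⟨exists_isMatrixLog n, fun _ hL =>
    TimeScale.isHyperbolicODE_odeCoeff hT hsynd hAcont hAbdd hAreg hsolv hL⟩
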